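/- Let $M$ be a smooth finite-dimensional manifold, $n\ge 1$, and let $(S^a,\sharp_a)_{1\le a\le n}$ be a regular graded Dirac structure of order $n$ on $M$. That is: $S^a\subseteq\bigwedge^a T^*M$ are smooth vector subbundles with $S^a=\iota_{TM}S^{a+1}$ for $1\le a<n$; with $K_p=\{U\in\bigwedge^pTM:\iota_US^p=0\}$, the maps $\sharp_a:S^a\to\bigwedge^{n+1-a}TM/K_{n+1-a}$ are smooth vector bundle maps, skew-symmetric, i.e. $\iota_{\sharp_a(\alpha)}\beta=(-1)^{(n+1-a)(n+1-b)}\iota_{\sharp_b(\beta)}\alpha$ for $\alpha\in S^a,\beta\in S^b$, and integrable: if $\alpha,\beta$ are sections of $S^a,S^b$ with $a+b\ge n+1$, and $U,V$ are multivector fields of orders $p=n+1-a$, $q=n+1-b$ representing $\sharp_a(\alpha),\sharp_b(\beta)$, then $$\theta=(-1)^{(p-1)q}\pounds_U\beta+(-1)^q\pounds_V\alpha-\tfrac{(-1)^q}{2}\,d\bigl(\iota_V\alpha+(-1)^{pq}\iota_U\beta\bigr)$$ takes values in $S^{a+b-n}$ and $\sharp_{a+b-n}(\theta)=[U,V]+K_{p+q-1}$.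 Here $\iota_{X_1\wedge\dots\wedge X_p}\omega=\omega(X_1,\dots,X_p,\cdot)$, $\pounds_U\omega=d\iota_U\omega-(-1)^p\iota_Ud\omega$, and $[\cdot,\cdot]$ is the Schouten–Nijenhuis bracket, with $[X_1\wedge\dots\wedge X_p,Y_1\wedge\dots\wedge Y_q]=\sum_{i,j}(-1)^{i+j}[X_i,Y_j]\wedge X_1\wedge\cdots\widehat{X_i}\cdots\wedge X_p\wedge Y_1\wedge\cdots\widehat{Y_j}\cdots\wedge Y_q$. For $k\ge1$ let $\widetilde\sharp_1:(S^1)^{\wedge k}\to\bigwedge^{k-1}T^*M\otimes\bigwedge^nTM/K_n$ be the unique map with $\iota_{\sharp_n(\gamma)}\beta=(-1)^{n+1-k}\iota_{\widetilde\sharp_1(\beta)}\gamma$ for all $\gamma\in S^n$, $\beta\in(S^1)^{\wedge k}$, where $\iota_{\theta\otimes u}\gamma=\theta\wedge\iota_u\gamma$. Let $\alpha$ be a smooth $(n-1)$-form on $M$ with $d\alpha\in S^n$ (a Hamiltonian form), let $a\ge 0$ and let $\Theta$ be a smooth $a$-form on $M$ with $d\Theta\in(S^1)^{\wedge(a+1)}$.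 Put $\{\alpha,\Theta\}=(-1)^{n-1-a}\,\iota_{\widetilde\sharp_1(d\Theta)}d\alpha$. Then $\{\alpha,\Theta\}$ is a smooth $a$-form with $d\{\alpha,\Theta\}\in(S^1)^{\wedge(a+1)}$, and $$\widetilde\sharp_1(d\{\alpha,\Theta\})=-\pounds_{\sharp_n(d\alpha)}\bigl(\widetilde\sharp_1(d\Theta)\bigr).$$ The right-hand side is meant as follows: near every point $\sharp_n(d\alpha)$ is represented modulo $K_1$ by a smooth vector field $X$ and $\widetilde\sharp_1(d\Theta)$ is represented modulo $K_n$ by a smooth section $\Psi$ of $\bigwedge^aT^*M\otimes\bigwedge^nTM$, and for every such local choice $-\pounds_X\Psi$ represents $\widetilde\sharp_1(d\{\alpha,\Theta\})$, where $\pounds_X(\theta\otimes u)=\pounds_X\theta\otimes u+\theta\otimes[X,u]$. -/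

import Mathlib

open scoped Manifold ContDiff

noncomputable section

namespace GDirac

/-! ## Exterior algebra on a finite-dimensional space `V` (a tangent space) -/

section LinearAlgebra

theorem append_update_left {V : Type*} {p k : ℕ} [DecidableEq (Fin p)] [DecidableEq (Fin (p + k))]
    (u : Fin p → V) (v : Fin k → V) (i : Fin p) (x : V) :
    Fin.append (Function.update u i x) v =
      Function.update (Fin.append u v) (Fin.castAdd k i) x := by
  ext j
  refine Fin.addCases (fun j => ?_) (fun j => ?_) j
  · by_cases h : j = i
    · subst h; simp
    · rw [Function.update_of_ne (by simpa using h)]; simp [h]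
  · rw [Function.update_of_ne (by
      intro h; have := congrArg Fin.val h; have := i.2; simp at *; omega)]
    simp

theorem append_update_right {V : Type*} {p k : ℕ} [DecidableEq (Fin k)] [DecidableEq (Fin (p + k))]
    (u : Fin p → V) (v : Fin k → V) (i : Fin k) (x : V) :
    Fin.append u (Function.update v i x) =
      Function.update (Fin.append u v) (Fin.natAdd p i) x := by
  ext j
  refine Fin.addCases (fun j => ?_) (fun j => ?_) j
  · rw [Function.update_of_ne (by
      intro h; have := congrArg Fin.val h; have := j.2; simp at *; omega)]
    simp
  · by_cases h : j = i
    · subst h; simp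
    · rw [Function.update_of_ne (by simpa using h)]; simp [h]

variable {V : Type*} [AddCommGroup V] [Module ℝ V] [TopologicalSpace V]
  [IsTopologicalAddGroup V] [ContinuousSMul ℝ V]

/-- `p`-vectors, i.e. elements of `Λ^p V`, realised (canonically, as `V` is finite-dimensional) as
linear functionals on the alternating `p`-forms; `v₁ ∧ ⋯ ∧ v_p` is the functional
`η ↦ η(v₁, …, v_p)`, so `U η` is the pairing `ι_U η` of a `p`-vector with a `p`-form.
The identification with Mathlib's `⋀[ℝ]^p V` is `multiVecEquiv` below. -/
abbrev MultiVec (p : ℕ) (V : Type*) [AddCommGroup V] [Module ℝ V] [TopologicalSpace V]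
    [IsTopologicalAddGroup V] [ContinuousSMul ℝ V] : Type _ :=
  Module.Dual ℝ (V [⋀^Fin p]→L[ℝ] ℝ)

/-- A vector, seen as a `1`-vector. -/
def ofVec (v : V) : MultiVec 1 V where
  toFun η := η (fun _ => v)
  map_add' _ _ := rfl
  map_smul' _ _ := rfl

/-- The annihilator `K_p = {U ∈ Λ^p V : ι_U S = 0}` of a space `S` of `p`-forms. -/
abbrev ann {p : ℕ} (S : Submodule ℝ (V [⋀^Fin p]→L[ℝ] ℝ)) : Submodule ℝ (MultiVec p V) :=
  S.dualAnnihilator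

/-- `(S)^{∧k}` for a space `S` of `1`-forms: the span of all `θ₁ ∧ ⋯ ∧ θ_k` with `θ_i ∈ S`, where
`(θ₁ ∧ ⋯ ∧ θ_k)(v₁, …, v_k) = det (θ_i(v_j))`. -/
def wedgePow (S : Submodule ℝ (V [⋀^Fin 1]→L[ℝ] ℝ)) (k : ℕ) :
    Submodule ℝ (V [⋀^Fin k]→L[ℝ] ℝ) :=
  Submodule.span ℝ {η | ∃ θ : Fin k → (V [⋀^Fin 1]→L[ℝ] ℝ), (∀ i, θ i ∈ S) ∧
    ∀ v : Fin k → V, η v = (Matrix.of fun i j => θ i (fun _ => v j)).det}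

variable [T2Space V] [FiniteDimensional ℝ V]

theorem continuous_multilinear {k : ℕ} {W : Type*} [AddCommGroup W] [Module ℝ W]
    [TopologicalSpace W] [ContinuousAdd W] [ContinuousSMul ℝ W]
    (f : MultilinearMap ℝ (fun _ : Fin k => V) W) : Continuous f := by
  classical
  let b := Module.finBasis ℝ V
  have h : ∀ v, f v = ∑ r : Fin k → Fin (Module.finrank ℝ V),
      (∏ i, b.equivFun (v i) (r i)) • f (fun i => b (r i)) := by
    intro v
    conv_lhs => rw [show v = fun i => ∑ j, b.equivFun (v i) j • b j from
      funext fun i => (b.sum_equivFun (v i)).symm]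
    rw [f.map_sum]
    exact Finset.sum_congr rfl fun r _ => f.map_smul_univ _ _
  have hb : Continuous b.equivFun := continuous_equivFun_basis b
  rw [show (f : (Fin k → V) → W) = _ from funext h]
  fun_prop

/-- Alternating maps on a finite-dimensional space are automatically continuous. -/
def altToCont {k : ℕ} {W : Type*} [AddCommGroup W] [Module ℝ W]
    [TopologicalSpace W] [IsTopologicalAddGroup W] [ContinuousSMul ℝ W] :
    (V [⋀^Fin k]→ₗ[ℝ] W) ≃ₗ[ℝ] (V [⋀^Fin k]→L[ℝ] W) where
  toFun f := { f with cont := continuous_multilinear f.toMultilinearMap }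
  invFun f := f.toAlternatingMap
  map_add' _ _ := rfl
  map_smul' _ _ := rfl
  left_inv _ := rfl
  right_inv _ := rfl

instance finiteDimensional_alt (k : ℕ) : FiniteDimensional ℝ (V [⋀^Fin k]→L[ℝ] ℝ) :=
  Module.Finite.of_injective
    (({ toFun := fun f => f.toMultilinearMap
        map_add' := fun _ _ => rfl
        map_smul' := fun _ _ => rfl } :
      (V [⋀^Fin k]→L[ℝ] ℝ) →ₗ[ℝ] MultilinearMap ℝ (fun _ : Fin k => V) ℝ))
    (fun f g h => by
      ext v
      exact congrArg (fun F : MultilinearMap ℝ (fun _ : Fin k => V) ℝ => F v) h)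

/-- The canonical isomorphism of Mathlib's `p`-th exterior power with `MultiVec p V`. -/
def multiVecEquiv (p : ℕ) : (⋀[ℝ]^p V) ≃ₗ[ℝ] MultiVec p V :=
  (Module.evalEquiv ℝ (⋀[ℝ]^p V)).trans <|
    ((altToCont (V := V) (k := p) (W := ℝ)).symm.trans
      exteriorPower.alternatingMapLinearEquiv).dualMap

theorem multiVecEquiv_ιMulti (p : ℕ) (v : Fin p → V) (η : V [⋀^Fin p]→L[ℝ] ℝ) :
    multiVecEquiv p (exteriorPower.ιMulti ℝ p v) η = η v := by
  simp [multiVecEquiv, altToCont]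

/-- The `p`-form `u ↦ η(u₁, …, u_p, v₁, …, v_k)`, for a `(p + k)`-form `η`. -/
def fixLast {p k m : ℕ} (h : p + k = m) (η : V [⋀^Fin m]→L[ℝ] ℝ) (v : Fin k → V) :
    V [⋀^Fin p]→L[ℝ] ℝ :=
  altToCont
    { toFun := fun u => η (Fin.append u v ∘ Fin.cast h.symm)
      map_update_add' := by
        subst h
        intro _ u i x y
        simp [append_update_left]
      map_update_smul' := by
        subst h
        intro _ u i c x
        simp [append_update_left]
      map_eq_zero_of_eq' := by
        subst h
        intro u i j hij hne
        refine η.map_eq_zero_of_eq _ (i := Fin.castAdd k i) (j := Fin.castAdd k j) ?_ ?_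
        · simpa using hij
        · simpa using hne }

/-- The contraction `ι_U η` of a `(p + k)`-form `η` with a `p`-vector `U`, a `k`-form. It is given
by `(ι_{u₁ ∧ ⋯ ∧ u_p} η)(v₁, …, v_k) = η(u₁, …, u_p, v₁, …, v_k)`. -/
def contract {p k m : ℕ} (h : p + k = m) (U : MultiVec p V) (η : V [⋀^Fin m]→L[ℝ] ℝ) :
    V [⋀^Fin k]→L[ℝ] ℝ :=
  altToCont
    { toFun := fun v => U (fixLast h η v)
      map_update_add' := by
        subst h
        intro _ v i x y
        rw [← map_add]
        congr 1
        ext u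
        change η (Fin.append u (Function.update v i (x + y))) =
          η (Fin.append u (Function.update v i x)) + η (Fin.append u (Function.update v i y))
        simp [append_update_right]
      map_update_smul' := by
        subst h
        intro _ v i c x
        rw [← map_smul]
        congr 1
        ext u
        change η (Fin.append u (Function.update v i (c • x))) =
          c • η (Fin.append u (Function.update v i x))
        simp [append_update_right]
      map_eq_zero_of_eq' := by
        subst h
        intro v i j hij hne
        rw [show fixLast rfl η v = 0 from ?_, map_zero]
        ext u
        refine η.map_eq_zero_of_eq _ (i := Fin.natAdd p i) (j := Fin.natAdd p j) ?_ ?_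
        · simpa using hij
        · simpa using hne }

theorem contract_apply {p k m : ℕ} (h : p + k = m) (U : MultiVec p V)
    (η : V [⋀^Fin m]→L[ℝ] ℝ) (v : Fin k → V) : contract h U η v = U (fixLast h η v) := rfl

theorem fixLast_apply {p k m : ℕ} (h : p + k = m) (η : V [⋀^Fin m]→L[ℝ] ℝ) (v : Fin k → V)
    (u : Fin p → V) : fixLast h η v u = η (Fin.append u v ∘ Fin.cast h.symm) := rfl

/-- `η ↦ ι_U η` as a linear map. -/
def contractForms {p k m : ℕ} (h : p + k = m) (U : MultiVec p V) :
    (V [⋀^Fin m]→L[ℝ] ℝ) →ₗ[ℝ] (V [⋀^Fin k]→L[ℝ] ℝ) where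
  toFun η := contract h U η
  map_add' η χ := by
    ext v
    rw [ContinuousAlternatingMap.add_apply, contract_apply, contract_apply, contract_apply,
      ← map_add]
    rfl
  map_smul' c η := by
    ext v
    rw [RingHom.id_apply, ContinuousAlternatingMap.smul_apply, contract_apply, contract_apply,
      ← map_smul]
    rfl

/-- `U ↦ ι_U η` as a linear map. -/
def contractVecs {p k m : ℕ} (h : p + k = m) (η : V [⋀^Fin m]→L[ℝ] ℝ) :
    MultiVec p V →ₗ[ℝ] (V [⋀^Fin k]→L[ℝ] ℝ) where
  toFun U := contract h U η
  map_add' _ _ := rfl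
  map_smul' _ _ := rfl

/-- If `S` is a space of `1`-forms and `U` annihilates `S`, then `ι_U` vanishes on `S^{∧(j+1)}`. -/
theorem contract_wedgePow {j : ℕ} (S : Submodule ℝ (V [⋀^Fin 1]→L[ℝ] ℝ)) {U : MultiVec 1 V}
    (hU : U ∈ ann S) {β : V [⋀^Fin (j + 1)]→L[ℝ] ℝ} (hβ : β ∈ wedgePow S (j + 1)) :
    contract (Nat.add_comm 1 j) U β = 0 := by
  have key : wedgePow S (j + 1) ≤ LinearMap.ker (contractForms (Nat.add_comm 1 j) U) := by
    refine Submodule.span_le.2 ?_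
    rintro η ⟨θ, hθ, hη⟩
    change contract (Nat.add_comm 1 j) U η = 0
    ext v
    rw [contract_apply]
    refine (Submodule.mem_dualAnnihilator U).1 hU _ ?_
    have hfix : fixLast (Nat.add_comm 1 j) η v = ∑ i : Fin (j + 1), ((-1 : ℝ) ^ (i : ℕ) *
        (Matrix.of fun a b : Fin j => θ (i.succAbove a) (fun _ => v b)).det) • θ i := by
      ext u
      have hcons : (Fin.append u v ∘ Fin.cast (Nat.add_comm 1 j).symm : Fin (j + 1) → V) =
          Fin.cons (u 0) v := by
        rw [Fin.append_left_eq_cons]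
        ext l
        simp
      have hu : u = fun _ => u 0 := funext fun l => by rw [Subsingleton.elim l 0]
      rw [fixLast_apply, hcons, hη, Matrix.det_succ_column_zero]
      simp only [ContinuousAlternatingMap.sum_apply, ContinuousAlternatingMap.smul_apply,
        smul_eq_mul, Matrix.of_apply, Fin.cons_zero]
      refine Finset.sum_congr rfl fun i _ => ?_
      rw [← hu, mul_assoc, mul_assoc, mul_comm (θ i u)]
      congr 2
    rw [hfix]
    exact S.sum_mem fun i _ => S.smul_mem _ (hθ i)
  exact key hβ

/-- The isomorphism `Λ^p V / K_p ≃ S^*`, `[U] ↦ (γ ↦ ι_U γ)`, with `K_p` the annihilator of `S`. -/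
abbrev quotAnnEquiv {p : ℕ} (S : Submodule ℝ (V [⋀^Fin p]→L[ℝ] ℝ)) :
    (MultiVec p V ⧸ ann S) ≃ₗ[ℝ] Module.Dual ℝ S :=
  Subspace.quotAnnihilatorEquiv S

/-- The contraction `ι_ψ γ` of `γ ∈ S` (a space of `p`-forms) with `ψ ∈ Λ^j V^* ⊗ Λ^p V / K_p`,
i.e. with an alternating map `ψ` from `V^j` to `Λ^p V / K_p`. For `ψ = θ ⊗ [u]` it is
`(ι_u γ) θ = θ ∧ ι_u γ`. -/
def contractVF {j p : ℕ} (S : Submodule ℝ (V [⋀^Fin p]→L[ℝ] ℝ))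
    (ψ : V [⋀^Fin j]→ₗ[ℝ] (MultiVec p V ⧸ ann S)) (γ : S) : V [⋀^Fin j]→L[ℝ] ℝ :=
  altToCont (((quotAnnEquiv S).toLinearMap.flip γ).compAlternatingMap ψ)

/-- `[U] ↦ ι_U β` for `[U] ∈ V / K_1`, `K_1` the annihilator of `S`, and `β ∈ S^{∧(j+1)}`. -/
def contractQuot {j : ℕ} (S : Submodule ℝ (V [⋀^Fin 1]→L[ℝ] ℝ))
    (β : V [⋀^Fin (j + 1)]→L[ℝ] ℝ) (hβ : β ∈ wedgePow S (j + 1)) :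
    (MultiVec 1 V ⧸ ann S) →ₗ[ℝ] (V [⋀^Fin j]→L[ℝ] ℝ) :=
  (ann S).liftQ (contractVecs (Nat.add_comm 1 j) β) fun _ hU => contract_wedgePow S hU hβ

/-- The extension `♯̃_1 : (S^1)^{∧(j+1)} → Λ^j V^* ⊗ Λ^n V / K_n` of `♯_1`, determined by
`ι_{♯_n(γ)} β = (-1)^{n+1-(j+1)} ι_{♯̃_1(β)} γ` for all `γ ∈ S^n`
(see `contractVF_tildeSharp` and `tildeSharp_unique`). -/
def tildeSharp {n j : ℕ} (S₁ : Submodule ℝ (V [⋀^Fin 1]→L[ℝ] ℝ))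
    (Sₙ : Submodule ℝ (V [⋀^Fin n]→L[ℝ] ℝ)) (sharpₙ : Sₙ →ₗ[ℝ] (MultiVec 1 V ⧸ ann S₁))
    (β : V [⋀^Fin (j + 1)]→L[ℝ] ℝ) (hβ : β ∈ wedgePow S₁ (j + 1)) :
    V [⋀^Fin j]→ₗ[ℝ] (MultiVec n V ⧸ ann Sₙ) :=
  (quotAnnEquiv Sₙ).symm.toLinearMap.compAlternatingMap
    { toFun := fun v =>
        { toFun := fun γ =>
            (-1 : ℝ) ^ ((n : ℤ) + 1 - (j + 1)) * contractQuot S₁ β hβ (sharpₙ γ) v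
          map_add' := fun γ γ' => by simp [mul_add]
          map_smul' := fun c γ => by simp; ring }
      map_update_add' := fun v i x y => by ext γ; simp [mul_add]
      map_update_smul' := fun v i c x => by ext γ; simp; ring
      map_eq_zero_of_eq' := fun v i k hik hne => by
        ext γ
        simp [(contractQuot S₁ β hβ (sharpₙ γ)).map_eq_zero_of_eq v hik hne] }

theorem contractVF_tildeSharp {n j : ℕ} (S₁ : Submodule ℝ (V [⋀^Fin 1]→L[ℝ] ℝ))
    (Sₙ : Submodule ℝ (V [⋀^Fin n]→L[ℝ] ℝ)) (sharpₙ : Sₙ →ₗ[ℝ] (MultiVec 1 V ⧸ ann S₁))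
    (β : V [⋀^Fin (j + 1)]→L[ℝ] ℝ) (hβ : β ∈ wedgePow S₁ (j + 1)) (γ : Sₙ) (U : MultiVec 1 V)
    (hU : Submodule.Quotient.mk U = sharpₙ γ) :
    contract (Nat.add_comm 1 j) U β =
      (-1 : ℝ) ^ ((n : ℤ) + 1 - (j + 1)) •
        contractVF Sₙ (tildeSharp S₁ Sₙ sharpₙ β hβ) γ := by
  ext v
  have h1 : contractVF Sₙ (tildeSharp S₁ Sₙ sharpₙ β hβ) γ v =
      (-1 : ℝ) ^ ((n : ℤ) + 1 - (j + 1)) * contractQuot S₁ β hβ (sharpₙ γ) v := by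
    change quotAnnEquiv Sₙ (tildeSharp S₁ Sₙ sharpₙ β hβ v) γ = _
    simp only [tildeSharp, LinearMap.compAlternatingMap_apply, LinearEquiv.coe_coe,
      LinearEquiv.apply_symm_apply]
    rfl
  have h2 : contractQuot S₁ β hβ (sharpₙ γ) = contract (Nat.add_comm 1 j) U β := by
    rw [← hU]; rfl
  rw [ContinuousAlternatingMap.smul_apply, h1, h2, smul_eq_mul, ← mul_assoc, ← mul_zpow]
  simp

theorem tildeSharp_unique {n j : ℕ} (Sₙ : Submodule ℝ (V [⋀^Fin n]→L[ℝ] ℝ))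
    (ψ φ : V [⋀^Fin j]→ₗ[ℝ] (MultiVec n V ⧸ ann Sₙ))
    (h : ∀ γ : Sₙ, contractVF Sₙ ψ γ = contractVF Sₙ φ γ) : ψ = φ := by
  ext v
  apply (quotAnnEquiv Sₙ).injective
  ext γ
  exact congrArg (fun F : V [⋀^Fin j]→L[ℝ] ℝ => F v) (h γ)

/-- `Λ^a V^* ⊗ Λ^p V`, seen as the space of alternating maps `V^a → Λ^p V`, is also the space of
linear maps `Λ^p V^* → Λ^a V^*`, `Ψ ↦ (γ ↦ ι_Ψ γ)`, where `(ι_Ψ γ)(v) = ι_{Ψ(v)} γ`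
(so `ι_{θ ⊗ u} γ = (ι_u γ) θ`). -/
def opEquiv {a p : ℕ} :
    (V [⋀^Fin a]→ₗ[ℝ] MultiVec p V) ≃
      ((V [⋀^Fin p]→L[ℝ] ℝ) →ₗ[ℝ] (V [⋀^Fin a]→L[ℝ] ℝ)) where
  toFun Ψ :=
    { toFun := fun γ => altToCont ((LinearMap.applyₗ γ).compAlternatingMap Ψ)
      map_add' := fun γ γ' => by ext v; exact map_add (Ψ v) γ γ'
      map_smul' := fun c γ => by ext v; exact map_smul (Ψ v) c γ }
  invFun T :=
    { toFun := fun v =>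
        { toFun := fun γ => T γ v
          map_add' := fun γ γ' => by simp
          map_smul' := fun c γ => by simp }
      map_update_add' := fun v i x y => by ext γ; simp
      map_update_smul' := fun v i c x => by ext γ; simp
      map_eq_zero_of_eq' := fun v i j hij hne => by
        ext γ
        exact (T γ).map_eq_zero_of_eq v hij hne }
  left_inv _ := rfl
  right_inv _ := rfl

theorem opEquiv_apply {a p : ℕ} (Ψ : V [⋀^Fin a]→ₗ[ℝ] MultiVec p V) (γ : V [⋀^Fin p]→L[ℝ] ℝ)
    (v : Fin a → V) : opEquiv Ψ γ v = Ψ v γ := rfl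

end LinearAlgebra

/-! ## Tensor fields on a manifold `M` modelled on `E` -/

section Manifold

variable (E : Type*) [NormedAddCommGroup E] [NormedSpace ℝ E]
  (M : Type*) [TopologicalSpace M] [ChartedSpace E M]

/-- Differential forms of degree `k` on `M` (smoothness is stated separately). -/
abbrev DForm (k : ℕ) : Type _ := ∀ x : M, TangentSpace 𝓘(ℝ, E) x [⋀^Fin k]→L[ℝ] ℝ

/-- Multivector fields of order `p`, i.e. sections of `Λ^p TM`. -/
abbrev MVField (p : ℕ) : Type _ := ∀ x : M, MultiVec p (TangentSpace 𝓘(ℝ, E) x)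

/-- Multivector-valued forms: sections of `Λ^a T^*M ⊗ Λ^p TM`. -/
abbrev MVForm (a p : ℕ) : Type _ :=
  ∀ x : M, TangentSpace 𝓘(ℝ, E) x [⋀^Fin a]→ₗ[ℝ] MultiVec p (TangentSpace 𝓘(ℝ, E) x)

variable {E M} [IsManifold 𝓘(ℝ, E) ∞ M]

variable [FiniteDimensional ℝ E]

instance t2Space_tangentSpace (x : M) : T2Space (TangentSpace 𝓘(ℝ, E) x) :=
  inferInstanceAs (T2Space E)

instance finiteDimensional_tangentSpace (x : M) :
    FiniteDimensional ℝ (TangentSpace 𝓘(ℝ, E) x) :=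
  inferInstanceAs (FiniteDimensional ℝ E)

/-- The derivative at `z` of the chart centred at `x`, `T_z M → E`. -/
def toModel (x z : M) : TangentSpace 𝓘(ℝ, E) z →L[ℝ] E :=
  haveI : IsManifold 𝓘(ℝ, E) 1 M := IsManifold.of_le (n := ∞) (by simp)
  (trivializationAt E (TangentSpace 𝓘(ℝ, E)) x).continuousLinearMapAt ℝ z

/-- The inverse of the derivative at `z` of the chart centred at `x`, `E → T_z M`. -/
def ofModel (x z : M) : E →L[ℝ] TangentSpace 𝓘(ℝ, E) z :=
  haveI : IsManifold 𝓘(ℝ, E) 1 M := IsManifold.of_le (n := ∞) (by simp)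
  (trivializationAt E (TangentSpace 𝓘(ℝ, E)) x).symmL ℝ z

/-- The coordinates of the point `x` in the chart centred at `x`. -/
abbrev pt (x : M) : E := extChartAt 𝓘(ℝ, E) x x

/-- The point with coordinates `y` in the chart centred at `x`. -/
abbrev unchart (x : M) (y : E) : M := (extChartAt 𝓘(ℝ, E) x).symm y

/-- A form in the chart centred at `x`. -/
def DForm.rep {k : ℕ} (η : DForm E M k) (x : M) (y : E) : E [⋀^Fin k]→L[ℝ] ℝ :=
  (η (unchart x y)).compContinuousLinearMap (ofModel x (unchart x y))

/-- A multivector field in the chart centred at `x`: the push-forward `⟨γ, f_* U⟩ = ⟨f^* γ, U⟩`. -/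
def MVField.rep {p : ℕ} (U : MVField E M p) (x : M) (y : E) : (E [⋀^Fin p]→L[ℝ] ℝ) →L[ℝ] ℝ :=
  LinearMap.toContinuousLinearMap
    (U (unchart x y) ∘ₗ
      ContinuousAlternatingMap.compContinuousLinearMapₗ (toModel x (unchart x y)))

/-- A multivector-valued form in the chart centred at `x`, as the operator `γ ↦ ι_Ψ γ`. -/
def MVForm.rep {a p : ℕ} (Ψ : MVForm E M a p) (x : M) (y : E) :
    (E [⋀^Fin p]→L[ℝ] ℝ) →L[ℝ] (E [⋀^Fin a]→L[ℝ] ℝ) :=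
  LinearMap.toContinuousLinearMap
    (ContinuousAlternatingMap.compContinuousLinearMapₗ (ofModel x (unchart x y)) ∘ₗ
      opEquiv (Ψ (unchart x y)) ∘ₗ
        ContinuousAlternatingMap.compContinuousLinearMapₗ (toModel x (unchart x y)))

/-- A vector field in the chart centred at `x`. -/
def vecRep (X : ∀ x : M, TangentSpace 𝓘(ℝ, E) x) (x : M) (y : E) : E :=
  toModel x (unchart x y) (X (unchart x y))

/-- The form `η` is smooth at every point of `O`. -/
def DForm.SmoothOn {k : ℕ} (η : DForm E M k) (O : Set M) : Prop :=
  ∀ x ∈ O, ContDiffAt ℝ ∞ (η.rep x) (pt x)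

/-- The multivector field `U` is smooth at every point of `O`. -/
def MVField.SmoothOn {p : ℕ} (U : MVField E M p) (O : Set M) : Prop :=
  ∀ x ∈ O, ContDiffAt ℝ ∞ (U.rep x) (pt x)

/-- The multivector-valued form `Ψ` is smooth at every point of `O`. -/
def MVForm.SmoothOn {a p : ℕ} (Ψ : MVForm E M a p) (O : Set M) : Prop :=
  ∀ x ∈ O, ContDiffAt ℝ ∞ (Ψ.rep x) (pt x)

/-- The vector field `X` is smooth at every point of `O`. -/
def VecSmoothOn (X : ∀ x : M, TangentSpace 𝓘(ℝ, E) x) (O : Set M) : Prop :=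
  ∀ x ∈ O, ContDiffAt ℝ ∞ (vecRep X x) (pt x)

/-- The exterior derivative `dη`. -/
def extD {k : ℕ} (η : DForm E M k) : DForm E M (k + 1) := fun x =>
  (extDeriv (η.rep x) (pt x)).compContinuousLinearMap (toModel x x)

/-- The contraction `ι_U η`. -/
def contr {p k m : ℕ} (h : p + k = m) (U : MVField E M p) (η : DForm E M m) : DForm E M k :=
  fun x => contract h (U x) (η x)

/-- The Lie derivative `£_U η = d ι_U η - (-1)^p ι_U dη` of a form of degree `m = p + k` along
a multivector field of order `p`. -/
def lieMV {p k m : ℕ} (h : p + k = m) (U : MVField E M p) (η : DForm E M m) :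
    DForm E M (k + 1) :=
  extD (contr h U η) -
    (-1 : ℝ) ^ p • contr (show p + (k + 1) = m + 1 by omega) U (extD η)

/-- For multivector fields `U`, `V` on the vector space `E`, given in coordinates, the functional
`η ↦ ⟨d(ι_V η), U⟩` at `y`, where the `(p + q + 1)`-form `η` is extended with constant
coefficients; `U` has order `p + 1` and `V` has order `q + 1`. -/
def dContrConst {p q r : ℕ} (h : (q + 1) + p = r)
    (U : E → (E [⋀^Fin (p + 1)]→L[ℝ] ℝ) →L[ℝ] ℝ) (V : E → (E [⋀^Fin (q + 1)]→L[ℝ] ℝ) →L[ℝ] ℝ)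
    (y : E) : (E [⋀^Fin r]→L[ℝ] ℝ) →L[ℝ] ℝ :=
  (U y) ∘L (ContinuousAlternatingMap.alternatizeUncurryFinCLM ℝ E ℝ) ∘L
    (fderiv ℝ (fun z => LinearMap.toContinuousLinearMap
      (contractForms h (V z : (E [⋀^Fin (q + 1)]→L[ℝ] ℝ) →ₗ[ℝ] ℝ))) y).flip

/-- The Schouten–Nijenhuis bracket `[U, V]` of multivector fields of orders `p + 1` and `q + 1`,
computed at `x` in the chart centred at `x` by
`⟨η, [U, V]⟩ = (-1)^{pq} ⟨d(ι_V η), U⟩ - ⟨d(ι_U η), V⟩`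
for the (closed) forms `η` of degree `p + q + 1` with constant coefficients. For vector fields this
is the Lie bracket, and `[X₀ ∧ ⋯ ∧ X_p, Y₀ ∧ ⋯ ∧ Y_q]` is the sum of
`(-1)^{i+j} [X_i, Y_j] ∧ X₀ ∧ ⋯ X̂_i ⋯ ∧ X_p ∧ Y₀ ∧ ⋯ Ŷ_j ⋯ ∧ Y_q`. -/
def schouten {p q : ℕ} (U : MVField E M (p + 1)) (V : MVField E M (q + 1)) :
    MVField E M (p + q + 1) := fun x =>
  ((-1 : ℝ) ^ (p * q) •
        dContrConst (show (q + 1) + p = p + q + 1 by omega) (U.rep x) (V.rep x) (pt x) -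
      dContrConst (show (p + 1) + q = p + q + 1 by omega) (V.rep x) (U.rep x) (pt x)).toLinearMap ∘ₗ
    ContinuousAlternatingMap.compContinuousLinearMapₗ (ofModel x x)

/-- The Lie derivative at `y` of a `k`-form with constant coefficients on `E` along a vector field
with Jacobian `A` at `y`: the form `(v₁, …, v_k) ↦ ∑ i, γ(v₁, …, A v_i, …, v_k)`. -/
def jacAct (k : ℕ) (A : E →L[ℝ] E) : (E [⋀^Fin k]→L[ℝ] ℝ) →L[ℝ] (E [⋀^Fin k]→L[ℝ] ℝ) :=
  (ContinuousAlternatingMap.fderivCompContinuousLinearMapCLM ℝ (ContinuousLinearMap.id ℝ E)).flip A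

/-- The Lie derivative `£_X Ψ` of a multivector-valued form along a vector field, i.e.
`£_X (θ ⊗ u) = £_X θ ⊗ u + θ ⊗ [X, u]`. In coordinates, with `A = DX` the Jacobian of `X`, the
pairing of `(£_X Ψ)(v₁, …, v_a)` with a `p`-form `γ` is
`⟨γ, (D_X Ψ)(v₁, …, v_a)⟩ + ∑ i, ⟨γ, Ψ(v₁, …, A v_i, …, v_a)⟩
  - ⟨∑ j, γ(…, A ·, …), Ψ(v₁, …, v_a)⟩`. -/
def lieVF {a p : ℕ} (X : ∀ x : M, TangentSpace 𝓘(ℝ, E) x) (Ψ : MVForm E M a p) :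
    MVForm E M a p := fun x =>
  let A : E →L[ℝ] E := fderiv ℝ (vecRep X x) (pt x)
  let Φ : (E [⋀^Fin p]→L[ℝ] ℝ) →L[ℝ] (E [⋀^Fin a]→L[ℝ] ℝ) :=
    fderiv ℝ (Ψ.rep x) (pt x) (vecRep X x (pt x)) +
      jacAct a A ∘L Ψ.rep x (pt x) - Ψ.rep x (pt x) ∘L jacAct p A
  opEquiv.symm
    (ContinuousAlternatingMap.compContinuousLinearMapₗ (toModel x x) ∘ₗ Φ.toLinearMap ∘ₗ
      ContinuousAlternatingMap.compContinuousLinearMapₗ (ofModel x x))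

/-- `S`, a family of subspaces of `Λ^a T_x^*M`, is a (smooth) vector subbundle of `Λ^a T^*M`:
locally it has a smooth frame. -/
def IsSubbundle {a : ℕ}
    (S : ∀ x : M, Submodule ℝ (TangentSpace 𝓘(ℝ, E) x [⋀^Fin a]→L[ℝ] ℝ)) : Prop :=
  ∀ x₀ : M, ∃ O : Set M, IsOpen O ∧ x₀ ∈ O ∧ ∃ (r : ℕ) (s : Fin r → DForm E M a),
    (∀ i, (s i).SmoothOn O) ∧
    ∀ x ∈ O, LinearIndependent ℝ (fun i => s i x) ∧
      Submodule.span ℝ (Set.range fun i => s i x) = S x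

end Manifold

/-! ## Graded Dirac structures -/

section Dirac

variable (E : Type*) [NormedAddCommGroup E] [NormedSpace ℝ E] [FiniteDimensional ℝ E]
  (M : Type*) [TopologicalSpace M] [ChartedSpace E M] [IsManifold 𝓘(ℝ, E) ∞ M]

/-- A regular graded Dirac structure of order `n` on `M`. Only the data `S a` and
`sharp a p`, `p = n + 1 - a`, with `1 ≤ a ≤ n` are meaningful; the range `1 ≤ a ≤ n` is written
`1 ≤ a`, `1 ≤ p`, `a + p = n + 1`. The annihilator `K_p` of `S^p` is `ann (S p x)`. -/
structure GradedDirac (n : ℕ) where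
  /-- the subbundles `S^a ⊆ Λ^a T^*M` -/
  S : ∀ (a : ℕ) (x : M), Submodule ℝ (TangentSpace 𝓘(ℝ, E) x [⋀^Fin a]→L[ℝ] ℝ)
  subbundle : ∀ a, 1 ≤ a → a ≤ n → IsSubbundle (S a)
  /-- `S^a = ι_{TM} S^{a+1}` -/
  contraction : ∀ a, 1 ≤ a → a < n → ∀ x, S a x = Submodule.span ℝ
    {χ | ∃ (v : TangentSpace 𝓘(ℝ, E) x), ∃ η ∈ S (a + 1) x,
      χ = contract (Nat.add_comm 1 a) (ofVec v) η}
  /-- the bundle maps `♯_a : S^a → Λ^p TM / K_p`, `p = n + 1 - a` -/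
  sharp : ∀ (a p : ℕ) (_ : a + p = n + 1) (x : M),
    S a x →ₗ[ℝ] (MultiVec p (TangentSpace 𝓘(ℝ, E) x) ⧸ ann (S p x))
  /-- `♯_a` is smooth: it maps smooth local sections of `S^a` to sections of the quotient bundle
  that locally lift to smooth multivector fields -/
  smooth : ∀ (a p : ℕ) (h : a + p = n + 1), 1 ≤ a → 1 ≤ p →
    ∀ (O : Set M), IsOpen O → ∀ α : DForm E M a, α.SmoothOn O → ∀ hα : ∀ x ∈ O, α x ∈ S a x,
    ∀ x₀ ∈ O, ∃ (O' : Set M) (hO' : O' ⊆ O), IsOpen O' ∧ x₀ ∈ O' ∧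
      ∃ U : MVField E M p, U.SmoothOn O' ∧
        ∀ (x : M) (hx : x ∈ O'),
          Submodule.Quotient.mk (U x) = sharp a p h x ⟨α x, hα x (hO' hx)⟩
  /-- skew-symmetry: `ι_{♯_a(α)} β = (-1)^{pq} ι_{♯_b(β)} α` -/
  skew : ∀ (a p b q k : ℕ) (ha : a + p = n + 1) (hb : b + q = n + 1),
    1 ≤ a → 1 ≤ p → 1 ≤ b → 1 ≤ q → ∀ (hpb : p + k = b) (hqa : q + k = a),
    ∀ (x : M) (α : S a x) (β : S b x) (U : MultiVec p (TangentSpace 𝓘(ℝ, E) x))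
      (V : MultiVec q (TangentSpace 𝓘(ℝ, E) x)),
      Submodule.Quotient.mk U = sharp a p ha x α → Submodule.Quotient.mk V = sharp b q hb x β →
      contract hpb U (β : TangentSpace 𝓘(ℝ, E) x [⋀^Fin b]→L[ℝ] ℝ) =
        (-1 : ℝ) ^ (p * q) • contract hqa V (α : TangentSpace 𝓘(ℝ, E) x [⋀^Fin a]→L[ℝ] ℝ)
  /-- integrability; here `♯_a(α) = [U]` and `♯_b(β) = [V]` with `U`, `V` of orders `p + 1` and
  `q + 1`, and `k + 1 = a + b - n ≥ 1` is the degree of the form `θ` -/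
  integrable : ∀ (a p b q k : ℕ) (ha : a + (p + 1) = n + 1) (hb : b + (q + 1) = n + 1),
    1 ≤ a → 1 ≤ b → ∀ (hpb : (p + 1) + k = b) (hqa : (q + 1) + k = a),
    ∀ (α : DForm E M a) (β : DForm E M b) (U : MVField E M (p + 1)) (V : MVField E M (q + 1)),
      α.SmoothOn Set.univ → β.SmoothOn Set.univ → U.SmoothOn Set.univ → V.SmoothOn Set.univ →
      ∀ (hα : ∀ x, α x ∈ S a x) (hβ : ∀ x, β x ∈ S b x),
      (∀ x, Submodule.Quotient.mk (U x) = sharp a (p + 1) ha x ⟨α x, hα x⟩) →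
      (∀ x, Submodule.Quotient.mk (V x) = sharp b (q + 1) hb x ⟨β x, hβ x⟩) →
      let θ : DForm E M (k + 1) :=
        (-1 : ℝ) ^ (p * (q + 1)) • lieMV hpb U β + (-1 : ℝ) ^ (q + 1) • lieMV hqa V α -
          ((-1 : ℝ) ^ (q + 1) / 2) •
            extD (contr hqa V α + (-1 : ℝ) ^ ((p + 1) * (q + 1)) • contr hpb U β)
      ∃ hθ : ∀ x, θ x ∈ S (k + 1) x, ∀ x,
        sharp (k + 1) (p + q + 1) (by omega) x ⟨θ x, hθ x⟩ =
          Submodule.Quotient.mk (schouten U V x)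

namespace GradedDirac

variable {E M} {m : ℕ} (D : GradedDirac E M (m + 1))

/-- Hamiltonian `(n-1)`-forms, for a structure of order `n = m + 1`: smooth `α` with `dα ∈ S^n`. -/
def IsHamiltonian (α : DForm E M m) : Prop :=
  α.SmoothOn Set.univ ∧ ∀ x, extD α x ∈ D.S (m + 1) x

/-- The space `Ω^a_H(M)[1]`: smooth `a`-forms `Θ` with `dΘ ∈ (S^1)^{∧(a+1)}`. -/
def IsHamiltonianOne {a : ℕ} (Θ : DForm E M a) : Prop :=
  Θ.SmoothOn Set.univ ∧ ∀ x, extD Θ x ∈ wedgePow (D.S 1 x) (a + 1)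

/-- The section `♯_n(dα)` of `TM / K_1`. -/
def hamVF (α : DForm E M m) (hα : D.IsHamiltonian α) (x : M) :
    MultiVec 1 (TangentSpace 𝓘(ℝ, E) x) ⧸ ann (D.S 1 x) :=
  D.sharp (m + 1) 1 rfl x ⟨extD α x, hα.2 x⟩

/-- The section `♯̃_1(dΘ)` of `Λ^a T^*M ⊗ Λ^n TM / K_n`, `n = m + 1`. -/
def tildeSharpD {a : ℕ} (Θ : DForm E M a) (hΘ : D.IsHamiltonianOne Θ) (x : M) :
    TangentSpace 𝓘(ℝ, E) x [⋀^Fin a]→ₗ[ℝ]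
      (MultiVec (m + 1) (TangentSpace 𝓘(ℝ, E) x) ⧸ ann (D.S (m + 1) x)) :=
  tildeSharp (D.S 1 x) (D.S (m + 1) x) (D.sharp (m + 1) 1 rfl x) (extD Θ x) (hΘ.2 x)

/-- The bracket `{α, Θ} = (-1)^{deg_H Θ} ι_{♯̃_1(dΘ)} dα`, with `deg_H Θ = (n - 1) - a` and
`n = m + 1`. -/
def bracket {a : ℕ} (α : DForm E M m) (hα : D.IsHamiltonian α) (Θ : DForm E M a)
    (hΘ : D.IsHamiltonianOne Θ) : DForm E M a := fun x =>
  (-1 : ℝ) ^ ((m : ℤ) - a) •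
    contractVF (D.S (m + 1) x) (D.tildeSharpD Θ hΘ x) ⟨extD α x, hα.2 x⟩

/-- `£_ξ σ = τ`, for a section `ξ` of `TM / K_1` and sections `σ`, `τ` of
`Λ^a T^*M ⊗ Λ^n TM / K_n`: near every point `ξ` and `σ` have smooth representatives `X` and `Ψ`
(a vector field and a multivector-valued form), and, whatever the local smooth representatives
chosen, `£_X Ψ` represents `τ`. -/
def IsLieDerivative {a : ℕ}
    (ξ : ∀ x : M, MultiVec 1 (TangentSpace 𝓘(ℝ, E) x) ⧸ ann (D.S 1 x))
    (σ τ : ∀ x : M, TangentSpace 𝓘(ℝ, E) x [⋀^Fin a]→ₗ[ℝ]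
      (MultiVec (m + 1) (TangentSpace 𝓘(ℝ, E) x) ⧸ ann (D.S (m + 1) x))) : Prop :=
  let Represents (O : Set M) (X : ∀ x : M, TangentSpace 𝓘(ℝ, E) x)
      (Ψ : MVForm E M a (m + 1)) : Prop :=
    VecSmoothOn X O ∧ Ψ.SmoothOn O ∧
      ∀ x ∈ O, Submodule.Quotient.mk (ofVec (X x)) = ξ x ∧
        ∀ v, Submodule.Quotient.mk (Ψ x v) = σ x v
  (∀ x, ∃ O : Set M, IsOpen O ∧ x ∈ O ∧ ∃ X Ψ, Represents O X Ψ) ∧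
  ∀ (O : Set M) (X : ∀ x : M, TangentSpace 𝓘(ℝ, E) x) (Ψ : MVForm E M a (m + 1)),
    IsOpen O → Represents O X Ψ →
      ∀ x ∈ O, ∀ v, Submodule.Quotient.mk (lieVF X Ψ x v) = τ x v

end GradedDirac

end Dirac

end GDirac

end

/-! Write n = m + 1 and ε = `tildeSign m a` = (-1)^(n-a). Near any point let X be a vector field
representing ♯_n(dα). The defining relation of ♯̃_1 says ι_Y dΘ = ε ι_{♯̃_1(dΘ)} γ whenever the
vector Y represents ♯_n(γ). For γ = dα the signs combine to {α, Θ} = -ι_X dΘ (`bracket_eq`). Hence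
the bracket is smooth, and Cartan's formula with d² = 0 gives d{α, Θ} = -£_X dΘ (`extD_bracket`).

Integrability enters through `lieAt_mem`. Since dα is closed and its representative X is a vector
field, skew-symmetry collapses the form θ of the axiom to £_X β. So £_X preserves the sections of
every S^k with 1 ≤ k ≤ n, and if V represents ♯_k(β), then [X, V] represents ♯_k(£_X β).

Membership: (S^1)^{∧(j+1)} consists of the forms killed by the common kernel of S^1
(`contract_wedgePow`, `mem_wedgePow`). As £_X preserves S^1, bracketing with X preserves the
sections W of that kernel, and £_X ι_W = ι_{[X,W]} + ι_W £_X shows that £_X preserves the sections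
of (S^1)^{∧(j+1)} (`lieAt_mem_wedgePow`).

Formula: let Ψ represent ♯̃_1(dΘ), let χ be a section of S^n and let Y represent ♯_n(χ).
Differentiate ι_Y dΘ = ε ι_Ψ χ along X. The terms ι_{[X,Y]} dΘ and ε ι_Ψ(£_X χ) agree, because [X,
Y] represents ♯_n(£_X χ). What remains is ι_Y £_X dΘ = ε ι_{£_X Ψ} χ, which is the claim paired with
χ (`mk_lieVF_eq`).

Smooth local representatives Ψ come from a frame of S^n and a smooth dual family
(`exists_tensor_rep`). -/

noncomputable section

set_option linter.unusedSectionVars false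

namespace GDirac

/-! ### Linear algebra in one tangent space -/

section LinearAlgebra

theorem exists_dual_family {W : Type*} [AddCommGroup W] [Module ℝ W] {r : ℕ} {s : Fin r → W}
    (hs : LinearIndependent ℝ s) :
    ∃ l : Fin r → Module.Dual ℝ W, ∀ i j, l i (s j) = if i = j then 1 else 0 := by
  let b := Module.Basis.span hs
  choose l hl using fun i => LinearMap.exists_extend (b.coord i)
  refine ⟨l, fun i j => ?_⟩
  have h := LinearMap.congr_fun (hl i) (b j)
  have hb : ((b j : Submodule.span ℝ (Set.range s)) : W) = s j :=
    congrArg Subtype.val (Module.Basis.span_apply hs j)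
  rw [LinearMap.comp_apply, Submodule.subtype_apply, hb, Module.Basis.coord_apply,
    Module.Basis.repr_self, Finsupp.single_apply] at h
  rw [h]
  exact if_congr eq_comm rfl rfl

theorem exists_frame {W : Type*} [AddCommGroup W] [Module ℝ W] [FiniteDimensional ℝ W]
    (S : Submodule ℝ W) :
    ∃ (r : ℕ) (s : Fin r → W), LinearIndependent ℝ s ∧ Submodule.span ℝ (Set.range s) = S := by
  let b := Module.finBasis ℝ S
  refine ⟨_, fun i => (b i : W), b.linearIndependent.map' S.subtype (Submodule.ker_subtype S), ?_⟩
  have h : Set.range (fun i => (b i : W)) = S.subtype '' Set.range b := by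
    rw [← Set.range_comp]; rfl
  rw [h, Submodule.span_image, b.span_eq, Submodule.map_top, Submodule.range_subtype]

theorem dual_family_sum {W : Type*} [AddCommGroup W] [Module ℝ W] {r : ℕ}
    {s : Fin r → W} {l : Fin r → Module.Dual ℝ W}
    (h : ∀ i j, l i (s j) = if i = j then 1 else 0) (c : Fin r → ℝ) (i : Fin r) :
    l i (∑ j, c j • s j) = c i := by
  simp [h]

theorem sum_dual_family {W : Type*} [AddCommGroup W] [Module ℝ W] {r : ℕ}
    {s : Fin r → W} {l : Fin r → Module.Dual ℝ W}
    (h : ∀ i j, l i (s j) = if i = j then 1 else 0) {w : W}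
    (hw : w ∈ Submodule.span ℝ (Set.range s)) : ∑ j, l j w • s j = w := by
  obtain ⟨c, rfl⟩ := (Submodule.mem_span_range_iff_exists_fun ℝ).1 hw
  exact Finset.sum_congr rfl fun j _ => by rw [dual_family_sum h]

theorem update_zero_fin_one {V : Type*} (v : V) (u : Fin 1 → V) :
    Function.update u 0 v = fun _ => v := by
  ext i; rw [Subsingleton.elim i 0]; simp

/-- A form unchanged by a projection along vectors that kill it. -/
theorem apply_eq_apply_proj {V : Type*} [AddCommGroup V] [Module ℝ V]
    [TopologicalSpace V] {k : ℕ} (β : V [⋀^Fin k]→L[ℝ] ℝ) (P : V → V)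
    (h : ∀ (w : Fin k → V) (i : Fin k) (v : V), w i = v - P v → β w = 0) (v : Fin k → V) :
    β v = β (fun i => P (v i)) := by
  classical
  -- The arguments are projected one at a time. Each replacement changes the value by β of a tuple
  -- with an entry `v a - P (v a)`, which vanishes; P need not be linear.
  have key : ∀ (t : Finset (Fin k)) (v : Fin k → V),
      β v = β (fun i => if i ∈ t then P (v i) else v i) := by
    intro t
    induction t using Finset.induction_on with
    | empty => simp
    | insert a t ha ih =>
      intro v
      rw [ih v]
      set u : Fin k → V := fun i => if i ∈ t then P (v i) else v i
      have hu : (fun i => if i ∈ insert a t then P (v i) else v i) =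
          Function.update u a (P (v a)) := by
        ext i
        by_cases hi : i = a
        · subst hi; simp
        · simp [hi, u]
      have hua : u = Function.update u a ((v a - P (v a)) + P (v a)) := by
        ext i
        by_cases hi : i = a
        · subst hi; simp [u, ha]
        · simp [hi]
      rw [hu]
      conv_lhs => rw [hua]
      rw [β.map_update_add, h (Function.update u a (v a - P (v a))) a (v a) (by simp), zero_add]
  simpa using key Finset.univ v

variable {V : Type*} [AddCommGroup V] [Module ℝ V] [TopologicalSpace V]
  [IsTopologicalAddGroup V] [ContinuousSMul ℝ V]

theorem ofVec_apply (v : V) (η : V [⋀^Fin 1]→L[ℝ] ℝ) : ofVec v η = η (fun _ => v) := rfl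

/-- `ofVec` as a linear map. -/
def ofVecLin : V →ₗ[ℝ] MultiVec 1 V where
  toFun := ofVec
  map_add' v w := by
    ext η
    have h := η.map_update_add (fun _ => 0) 0 v w
    simp only [update_zero_fin_one] at h
    exact h
  map_smul' c v := by
    ext η
    have h := η.map_update_smul (fun _ => 0) 0 c v
    simp only [update_zero_fin_one] at h
    exact h

theorem ofVecLin_apply (v : V) : ofVecLin v = ofVec v := rfl

variable [T2Space V] [FiniteDimensional ℝ V]

theorem contract_ofVec_apply {k m : ℕ} (h : 1 + k = m) (h' : m = k + 1) (v : V)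
    (η : V [⋀^Fin m]→L[ℝ] ℝ) (w : Fin k → V) :
    contract h (ofVec v) η w = η (Fin.cons v w ∘ Fin.cast h') := by
  rw [contract_apply, ofVec_apply, fixLast_apply, Fin.append_left_eq_cons]
  congr 1

/-- The `1`-form with a given underlying functional. -/
def oneForm : Module.Dual ℝ V →ₗ[ℝ] (V [⋀^Fin 1]→L[ℝ] ℝ) where
  toFun f := altToCont (AlternatingMap.ofSubsingleton ℝ V ℝ (0 : Fin 1) f)
  map_add' _ _ := by ext; rfl
  map_smul' _ _ := by ext; rfl

theorem oneForm_apply (f : Module.Dual ℝ V) (v : Fin 1 → V) : oneForm f v = f (v 0) := rfl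

/-- A `1`-vector, seen as a vector. -/
def toVec : MultiVec 1 V →ₗ[ℝ] V :=
  ∑ i, (LinearMap.applyₗ (oneForm ((Module.finBasis ℝ V).coord i))).smulRight
    (Module.finBasis ℝ V i)

/-- Reflexivity of V in disguise: a 1-vector is determined by its values on the dual basis, and
`toVec` takes these values as coordinates. -/
theorem ofVec_toVec (U : MultiVec 1 V) : ofVec (toVec U) = U := by
  ext η
  set b := Module.finBasis ℝ V with hb
  have hη : η = ∑ i, ofVec (b i) η • oneForm (b.coord i) := by
    ext v
    have hv : v = fun _ => v 0 := funext fun l => by rw [Subsingleton.elim l 0]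
    have h1 : ofVecLin (v 0) η = ∑ i, b.repr (v 0) i * ofVec (b i) η := by
      conv_lhs => rw [← b.sum_repr (v 0)]
      rw [map_sum, LinearMap.sum_apply]
      exact Finset.sum_congr rfl fun i _ => by
        rw [map_smul, LinearMap.smul_apply, smul_eq_mul, ofVecLin_apply]
    rw [ofVecLin_apply, ofVec_apply, ← hv] at h1
    rw [h1, ContinuousAlternatingMap.sum_apply]
    refine Finset.sum_congr rfl fun i _ => ?_
    rw [ContinuousAlternatingMap.smul_apply, oneForm_apply, smul_eq_mul, mul_comm]
    rfl
  have h2 : ofVecLin (toVec U) η = ∑ i, U (oneForm (b.coord i)) * ofVec (b i) η := by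
    rw [toVec, LinearMap.sum_apply, map_sum, LinearMap.sum_apply]
    refine Finset.sum_congr rfl fun i _ => ?_
    rw [LinearMap.smulRight_apply, map_smul, LinearMap.smul_apply, smul_eq_mul, ofVecLin_apply]
    rfl
  rw [← ofVecLin_apply, h2]
  conv_rhs => rw [hη]
  rw [map_sum]
  exact Finset.sum_congr rfl fun i _ => by rw [map_smul, smul_eq_mul, mul_comm]

theorem ofVec_injective : Function.Injective (ofVec (V := V)) := by
  intro v w h
  refine (Module.finBasis ℝ V).ext_elem fun i => ?_
  exact LinearMap.congr_fun h (oneForm ((Module.finBasis ℝ V).coord i))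

/-- The form `θ₁ ∧ ⋯ ∧ θ_k`. -/
def wedgeForm {k : ℕ} (f : Fin k → Module.Dual ℝ V) : V [⋀^Fin k]→L[ℝ] ℝ :=
  altToCont (Matrix.detRowAlternating.compLinearMap (LinearMap.pi f))

theorem wedgeForm_apply {k : ℕ} (f : Fin k → Module.Dual ℝ V) (v : Fin k → V) :
    wedgeForm f v = (Matrix.of fun i j => f i (v j)).det := by
  rw [← Matrix.det_transpose]; rfl

/-- Multilinear expansion gives a sum over all multi-indices r. Replacing r by r ∘ σ and summing
over σ turns the products of the f's into determinants; the factor k! is the price of not ordering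
the multi-indices. -/
theorem factorial_mul_apply_sum {k n : ℕ} (β : V [⋀^Fin k]→L[ℝ] ℝ) (e : Fin n → V)
    (f : Fin n → Module.Dual ℝ V) (v : Fin k → V) :
    (k.factorial : ℝ) * β (fun i => ∑ j, f j (v i) • e j) =
      ∑ r : Fin k → Fin n, β (fun i => e (r i)) * wedgeForm (fun i => f (r i)) v := by
  have h0 : β (fun i => ∑ j, f j (v i) • e j) =
      ∑ r : Fin k → Fin n, (∏ i, f (r i) (v i)) * β (fun i => e (r i)) := by
    change β.toMultilinearMap _ = _
    rw [MultilinearMap.map_sum]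
    exact Finset.sum_congr rfl fun r _ => β.toMultilinearMap.map_smul_univ _ _
  have h1 : ∀ σ : Equiv.Perm (Fin k), β (fun i => ∑ j, f j (v i) • e j) =
      ∑ r : Fin k → Fin n, ((Equiv.Perm.sign σ : ℤ) : ℝ) *
        ((∏ i, f (r (σ i)) (v i)) * β (fun i => e (r i))) := by
    intro σ
    rw [h0, ← (Equiv.arrowCongr σ.symm (Equiv.refl (Fin n))).sum_comp]
    refine Finset.sum_congr rfl fun r _ => ?_
    have h2 : β (fun i => e (r (σ i))) = ((Equiv.Perm.sign σ : ℤ) : ℝ) * β (fun i => e (r i)) := by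
      have := β.toAlternatingMap.map_perm (fun i => e (r i)) σ
      rw [Units.smul_def, zsmul_eq_mul] at this
      exact this
    change (∏ i, f (r (σ i)) (v i)) * β (fun i => e (r (σ i))) = _
    rw [h2]
    ring
  calc (k.factorial : ℝ) * β (fun i => ∑ j, f j (v i) • e j)
      = ∑ _σ : Equiv.Perm (Fin k), β (fun i => ∑ j, f j (v i) • e j) := by
        rw [Finset.sum_const, Finset.card_univ, Fintype.card_perm, Fintype.card_fin, nsmul_eq_mul]
    _ = ∑ σ : Equiv.Perm (Fin k), ∑ r : Fin k → Fin n, ((Equiv.Perm.sign σ : ℤ) : ℝ) *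
        ((∏ i, f (r (σ i)) (v i)) * β (fun i => e (r i))) :=
        Finset.sum_congr rfl fun σ _ => h1 σ
    _ = _ := by
        rw [Finset.sum_comm]
        refine Finset.sum_congr rfl fun r _ => ?_
        rw [wedgeForm_apply, Matrix.det_apply', Finset.mul_sum]
        refine Finset.sum_congr rfl fun σ _ => ?_
        simp only [Matrix.of_apply]
        ring

/-- A form killed by the common kernel of a space `S` of `1`-forms lies in `S^{∧k}`. -/
theorem mem_wedgePow {k : ℕ} (S : Submodule ℝ (V [⋀^Fin 1]→L[ℝ] ℝ)) (β : V [⋀^Fin k]→L[ℝ] ℝ)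
    (h : ∀ (w : Fin k → V) (i : Fin k), (∀ s ∈ S, s (fun _ => w i) = 0) → β w = 0) :
    β ∈ wedgePow S k := by
  obtain ⟨n, b, hb, hbS⟩ := exists_frame S
  obtain ⟨l, hl⟩ := exists_dual_family hb
  -- The vectors e_i are dual to the basis b of S, so v ↦ ∑ f_j(v) e_j is the projection along the
  -- common kernel of S onto the span of the e_i. The form β factors through it, and its expansion
  -- involves only wedges of the b_i.
  let e : Fin n → V := fun i => toVec (l i)
  have he : ∀ i j, b j (fun _ => e i) = if i = j then 1 else 0 := by
    intro i j
    rw [← hl i j, ← ofVec_apply, ofVec_toVec]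
  let f : Fin n → Module.Dual ℝ V := fun i => LinearMap.flip ofVecLin (b i)
  have hf : ∀ i v, f i v = b i (fun _ => v) := fun _ _ => rfl
  have hker : ∀ v, ∀ s ∈ S, s (fun _ => v - ∑ j, f j v • e j) = 0 := by
    intro v s hs
    have hle : S ≤ LinearMap.ker (ofVec (v - ∑ j, f j v • e j)) := by
      rw [← hbS, Submodule.span_le]
      rintro _ ⟨j, rfl⟩
      change f j (v - ∑ j, f j v • e j) = 0
      rw [map_sub, map_sum]
      simp_rw [map_smul, smul_eq_mul, hf, he]
      simp
    exact hle hs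
  have hβ : β = ∑ r : Fin k → Fin n, ((k.factorial : ℝ)⁻¹ * β (fun i => e (r i))) •
      wedgeForm (fun i => f (r i)) := by
    ext v
    have h1 := apply_eq_apply_proj β (fun v => ∑ j, f j v • e j)
      (fun w i u hw => h w i fun s hs => by rw [hw]; exact hker u s hs) v
    have h2 := factorial_mul_apply_sum β e f v
    have h3 : (k.factorial : ℝ) ≠ 0 := by exact_mod_cast k.factorial_ne_zero
    rw [h1, ← inv_mul_cancel_left₀ h3 (β fun i => ∑ j, f j (v i) • e j), h2,
      ContinuousAlternatingMap.sum_apply, Finset.mul_sum]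
    exact Finset.sum_congr rfl fun r _ => by
      rw [ContinuousAlternatingMap.smul_apply, smul_eq_mul, mul_assoc]
  rw [hβ]
  refine Submodule.sum_mem _ fun r _ => Submodule.smul_mem _ _ (Submodule.subset_span ?_)
  refine ⟨fun i => b (r i), fun i => ?_, fun v => wedgeForm_apply _ v⟩
  rw [← hbS]
  exact Submodule.subset_span ⟨_, rfl⟩

end LinearAlgebra

/-! ### Calculus of forms in a vector space -/

section Calculus

open ContinuousAlternatingMap

variable {E : Type*} [NormedAddCommGroup E] [NormedSpace ℝ E]

theorem jacAct_apply {k : ℕ} (A : E →L[ℝ] E) (γ : E [⋀^Fin k]→L[ℝ] ℝ) (v : Fin k → E) :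
    jacAct k A γ v = ∑ i, γ (Function.update v i (A (v i))) := by
  change γ.fderivCompContinuousLinearMap (ContinuousLinearMap.id ℝ E) A v = _
  rw [fderivCompContinuousLinearMap_apply]
  refine Finset.sum_congr rfl fun i _ => ?_
  congr 1
  ext j
  by_cases h : j = i
  · subst h; simp
  · simp [h]

/-- The Lie derivative of a form on a vector space along a vector field, at a point. -/
def flatLie {k : ℕ} (X : E → E) (η : E → E [⋀^Fin k]→L[ℝ] ℝ) (y : E) : E [⋀^Fin k]→L[ℝ] ℝ :=
  fderiv ℝ η y (X y) + jacAct k (fderiv ℝ X y) (η y)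

theorem flatLie_congr {k : ℕ} (X : E → E) {η η' : E → E [⋀^Fin k]→L[ℝ] ℝ} {y : E}
    (h : η =ᶠ[nhds y] η') : flatLie X η y = flatLie X η' y := by
  rw [flatLie, flatLie, h.fderiv_eq, h.eq_of_nhds]

theorem flatLie_zero {k : ℕ} (X : E → E) (y : E) :
    flatLie X (fun _ => (0 : E [⋀^Fin k]→L[ℝ] ℝ)) y = 0 := by
  simp [flatLie]

theorem flatLie_const_smul {k : ℕ} (X : E → E) (c : ℝ) {η : E → E [⋀^Fin k]→L[ℝ] ℝ} {y : E}
    (hη : DifferentiableAt ℝ η y) : flatLie X (fun z => c • η z) y = c • flatLie X η y := by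
  have : fderiv ℝ (fun z => c • η z) y = c • fderiv ℝ η y := (hη.hasFDerivAt.const_smul c).fderiv
  rw [flatLie, flatLie, this]
  simp

/-- `ContinuousAlternatingMap.curryLeft` as a continuous linear map. -/
def curryCLM (k : ℕ) : (E [⋀^Fin (k + 1)]→L[ℝ] ℝ) →L[ℝ] (E →L[ℝ] E [⋀^Fin k]→L[ℝ] ℝ) :=
  curryLeftLI.toContinuousLinearMap

theorem hasFDerivAt_curryCLM (k : ℕ) (γ : E [⋀^Fin (k + 1)]→L[ℝ] ℝ) :
    HasFDerivAt (curryCLM (E := E) k) (curryCLM k) γ :=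
  ContinuousLinearMap.hasFDerivAt (F := E →L[ℝ] E [⋀^Fin k]→L[ℝ] ℝ) (curryCLM k)

theorem contDiff_curryCLM (k : ℕ) {n : WithTop ℕ∞} : ContDiff ℝ n (curryCLM (E := E) k) := by
  fun_prop

theorem hasFDerivAt_curryLeft {k : ℕ} {η : E → E [⋀^Fin (k + 1)]→L[ℝ] ℝ} {y : E}
    (hη : DifferentiableAt ℝ η y) :
    HasFDerivAt (fun z => (η z).curryLeft) (curryCLM (E := E) k ∘L fderiv ℝ η y) y := by
  have h := hη.hasFDerivAt
  generalize fderiv ℝ η y = η' at *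
  exact HasFDerivAt.comp (g := fun γ : E [⋀^Fin (k + 1)]→L[ℝ] ℝ => γ.curryLeft)
    (g' := curryCLM (E := E) k) y (hasFDerivAt_curryCLM k _) h

theorem fderiv_curry_apply {k : ℕ} {η : E → E [⋀^Fin (k + 1)]→L[ℝ] ℝ} {W : E → E} {y : E}
    (hη : DifferentiableAt ℝ η y) (hW : DifferentiableAt ℝ W y) (u : E) :
    fderiv ℝ (fun z => (η z).curryLeft (W z)) y u =
      (fderiv ℝ η y u).curryLeft (W y) + (η y).curryLeft (fderiv ℝ W y u) := by
  rw [((hasFDerivAt_curryLeft hη).clm_apply hW.hasFDerivAt).fderiv, add_comm]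
  rfl

theorem contDiffAt_curry {k : ℕ} {n : WithTop ℕ∞} {η : E → E [⋀^Fin (k + 1)]→L[ℝ] ℝ} {W : E → E}
    {y : E} (hη : ContDiffAt ℝ n η y) (hW : ContDiffAt ℝ n W y) :
    ContDiffAt ℝ n (fun z => (η z).curryLeft (W z)) y := by
  have h1 : ContDiffAt ℝ n (fun z => (η z).curryLeft) y :=
    ContDiffAt.comp (G := E →L[ℝ] E [⋀^Fin k]→L[ℝ] ℝ) y (contDiff_curryCLM k).contDiffAt hη
  exact h1.clm_apply hW

/-- The sum over slots splits into the slot occupied by w and the remaining ones. -/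
theorem jacAct_curry {k : ℕ} (A : E →L[ℝ] E) (γ : E [⋀^Fin (k + 1)]→L[ℝ] ℝ) (w : E) :
    (jacAct (k + 1) A γ).curryLeft w = γ.curryLeft (A w) + jacAct k A (γ.curryLeft w) := by
  ext v
  rw [ContinuousAlternatingMap.add_apply, curryLeft_apply_apply, curryLeft_apply_apply,
    jacAct_apply, jacAct_apply, Fin.sum_univ_succ]
  congr 1
  · congr 1
    ext j
    refine Fin.cases ?_ (fun j => ?_) j <;> simp [Matrix.vecCons]
  · refine Finset.sum_congr rfl fun i _ => ?_
    rw [curryLeft_apply_apply]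
    congr 1
    simp [Matrix.vecCons, Fin.cons_update]

/-- £_X ι_W = ι_{[X,W]} + ι_W £_X: the term DW·X from the product rule and the term DX·W from
`jacAct_curry` combine to the bracket. Both the membership and the final formula rest on this
identity. -/
theorem flatLie_curry {k : ℕ} {X W : E → E} {η : E → E [⋀^Fin (k + 1)]→L[ℝ] ℝ} {y : E}
    (hη : DifferentiableAt ℝ η y) (hW : DifferentiableAt ℝ W y) :
    flatLie X (fun z => (η z).curryLeft (W z)) y =
      (η y).curryLeft (VectorField.lieBracket ℝ X W y) + (flatLie X η y).curryLeft (W y) := by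
  rw [flatLie, flatLie, fderiv_curry_apply hη hW, VectorField.lieBracket_eq, curryLeft_add,
    _root_.add_apply, jacAct_curry]
  simp only [map_sub]
  abel

/-- Cartan's formula. -/
theorem extDeriv_curry_add {k : ℕ} {X : E → E} {η : E → E [⋀^Fin (k + 1)]→L[ℝ] ℝ} {y : E}
    (hη : DifferentiableAt ℝ η y) (hX : DifferentiableAt ℝ X y) :
    extDeriv (fun z => (η z).curryLeft (X z)) y + (extDeriv η y).curryLeft (X y) =
      flatLie X η y := by
  ext v
  rw [ContinuousAlternatingMap.add_apply, curryLeft_apply_apply, flatLie,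
    ContinuousAlternatingMap.add_apply, jacAct_apply, extDeriv, extDeriv,
    alternatizeUncurryFin_apply, alternatizeUncurryFin_apply, Fin.sum_univ_succ (n := k + 1)]
  simp only [fderiv_curry_apply hη hX, ContinuousAlternatingMap.add_apply, curryLeft_apply_apply,
    smul_add, Finset.sum_add_distrib]
  -- The terms of dι_X η in which X is differentiated are those of `jacAct`, once slot i is moved to
  -- the front with sign (-1)^i.
  have h1 : ∀ i : Fin (k + 1), η y (Function.update v i (fderiv ℝ X y (v i))) =
      (-1) ^ (i : ℕ) • η y (Matrix.vecCons (fderiv ℝ X y (v i)) (i.removeNth v)) := by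
    intro i
    rw [← map_insertNth, Fin.insertNth_removeNth]
  -- The derivatives of η in the directions v_i occur in ι_X dη shifted by one slot, so they cancel
  -- those in dι_X η. Only slot 0, the derivative along X, survives.
  have h2 : ∀ i : Fin (k + 1), (-1) ^ (i.succ : ℕ) • fderiv ℝ η y (Matrix.vecCons (X y) v i.succ)
      (i.succ.removeNth (Matrix.vecCons (X y) v)) =
      - ((-1) ^ (i : ℕ) • fderiv ℝ η y (v i) (Matrix.vecCons (X y) (i.removeNth v))) := by
    intro i
    have h3 : i.succ.removeNth (Matrix.vecCons (X y) v) =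
        (Matrix.vecCons (X y) (i.removeNth v) : Fin (k + 1) → E) := by
      ext j
      refine Fin.cases ?_ (fun j => ?_) j <;> simp [Fin.removeNth, Matrix.vecCons]
    rw [h3, Fin.val_succ, pow_succ, Matrix.cons_val_succ]
    simp
  simp only [h1, h2, Finset.sum_neg_distrib]
  have h4 : (0 : Fin (k + 2)).removeNth (Matrix.vecCons (X y) v) = v := by
    ext j; simp [Fin.removeNth]
  rw [h4]
  simp
  abel

/-- The Lie derivative of a field of linear operators between spaces of forms. -/
def flatLieOp {a p : ℕ} (X : E → E) (T : E → (E [⋀^Fin p]→L[ℝ] ℝ) →L[ℝ] (E [⋀^Fin a]→L[ℝ] ℝ))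
    (y : E) : (E [⋀^Fin p]→L[ℝ] ℝ) →L[ℝ] (E [⋀^Fin a]→L[ℝ] ℝ) :=
  fderiv ℝ T y (X y) + jacAct a (fderiv ℝ X y) ∘L T y - T y ∘L jacAct p (fderiv ℝ X y)

/-- Leibniz rule £_X(T γ) = (£_X T) γ + T(£_X γ): the action of DX on the p-form γ enters the two
summands with opposite signs. -/
theorem flatLie_apply {a p : ℕ} {X : E → E}
    {T : E → (E [⋀^Fin p]→L[ℝ] ℝ) →L[ℝ] (E [⋀^Fin a]→L[ℝ] ℝ)} {γ : E → E [⋀^Fin p]→L[ℝ] ℝ} {y : E}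
    (hT : DifferentiableAt ℝ T y) (hγ : DifferentiableAt ℝ γ y) :
    flatLie X (fun z => T z (γ z)) y = flatLieOp X T y (γ y) + T y (flatLie X γ y) := by
  rw [flatLie, fderiv_clm_apply hT hγ, flatLie, flatLieOp]
  simp only [_root_.add_apply, _root_.sub_apply,
    ContinuousLinearMap.comp_apply, ContinuousLinearMap.flip_apply, map_add]
  abel

/-- A smooth frame has a smooth dual family. -/
theorem exists_smooth_dual_family {F : Type*} [NormedAddCommGroup F] [NormedSpace ℝ F]
    [FiniteDimensional ℝ F] {n : WithTop ℕ∞} {r : ℕ} {s : Fin r → E → F} {y : E}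
    (hs : ∀ i, ContinuousAt (s i) y) (hli : LinearIndependent ℝ fun i => s i y) :
    ∃ q : Fin r → E → F →L[ℝ] ℝ, ∀ᶠ z in nhds y,
      (∀ i j, q i z (s j z) = if i = j then 1 else 0) ∧
      ((∀ i, ContDiffAt ℝ n (s i) z) → ∀ i, ContDiffAt ℝ n (q i) z) := by
  obtain ⟨l, hl⟩ := exists_dual_family hli
  let L : F →L[ℝ] (Fin r → ℝ) := LinearMap.toContinuousLinearMap (LinearMap.pi l)
  let J : Fin r → F →L[ℝ] (Fin r → ℝ) →L[ℝ] F := fun j =>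
    ContinuousLinearMap.smulRightL ℝ (Fin r → ℝ) F
      (ContinuousLinearMap.proj (R := ℝ) (φ := fun _ : Fin r => ℝ) j)
  let S : E → (Fin r → ℝ) →L[ℝ] F := fun z => ∑ j, J j (s j z)
  have hSapp : ∀ z c, S z c = ∑ j, c j • s j z := fun z c => by simp [S, J]
  let T : E → (Fin r → ℝ) →L[ℝ] (Fin r → ℝ) := fun z => L ∘L S z
  have hS : ContinuousAt S y :=
    tendsto_finsetSum _ fun j _ => ((J j).continuous.continuousAt.comp (hs j)).tendsto
  have hT : ContinuousAt T y := continuousAt_const.clm_comp hS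
  have hTy : T y = 1 := by
    ext c i
    change l i (S y _) = _
    rw [hSapp, dual_family_sum hl]
    rfl
  have hunit : ∀ᶠ z in nhds y, IsUnit (T z) :=
    hT.eventually (Units.isOpen.mem_nhds (by
      rw [Set.mem_ofPred_eq, hTy]; exact isUnit_one))
  refine ⟨fun i z => ContinuousLinearMap.proj i ∘L Ring.inverse (T z) ∘L L, ?_⟩
  filter_upwards [hunit] with z hz
  refine ⟨fun i j => ?_, fun hsz i => ?_⟩
  · have h1 : L (s j z) = T z (Pi.single j 1) := by
      change _ = L (S z _)
      rw [hSapp]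
      congr 1
      simp [Pi.single_apply]
    change (Ring.inverse (T z) (L (s j z))) i = _
    rw [h1, ← mul_apply_eq_comp, Ring.inverse_mul_cancel _ hz]
    simp [Pi.single_apply]
  · have hSz : ContDiffAt ℝ n S z :=
      ContDiffAt.sum fun j _ => (J j).contDiff.contDiffAt.comp z (hsz j)
    have hTz : ContDiffAt ℝ n T z := contDiffAt_const.clm_comp hSz
    obtain ⟨u, hu⟩ := hz
    have h := contDiffAt_ringInverse ℝ (n := n) u
    rw [hu] at h
    exact contDiffAt_const.clm_comp ((h.comp z hTz).clm_comp contDiffAt_const)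

variable [FiniteDimensional ℝ E]

/-- The values on tuples of basis vectors embed the forms linearly into a space of coordinates, and
a linear left inverse recovers η smoothly. -/
theorem contDiffAt_alt_of_apply {k : ℕ} {G : Type*} [NormedAddCommGroup G]
    [NormedSpace ℝ G] {n : WithTop ℕ∞} {η : G → E [⋀^Fin k]→L[ℝ] ℝ} {y : G}
    (h : ∀ v, ContDiffAt ℝ n (fun z => η z v) y) : ContDiffAt ℝ n η y := by
  let b := Module.finBasis ℝ E
  let T : (E [⋀^Fin k]→L[ℝ] ℝ) →ₗ[ℝ] ((Fin k → Fin (Module.finrank ℝ E)) → ℝ) :=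
    { toFun := fun χ r => χ (fun i => b (r i))
      map_add' := fun _ _ => rfl
      map_smul' := fun _ _ => rfl }
  have hT : LinearMap.ker T = ⊥ := by
    refine LinearMap.ker_eq_bot'.2 fun χ hη => ?_
    have : χ.toAlternatingMap = 0 :=
      b.ext_alternating fun r _ => congrFun hη r
    ext v
    exact congrArg (fun F : E [⋀^Fin k]→ₗ[ℝ] ℝ => F v) this
  obtain ⟨L, hL⟩ := T.exists_leftInverse_of_injective hT
  have h1 : η = fun z => L.toContinuousLinearMap (fun r => η z (fun i => b (r i))) := by
    ext1 z
    exact (LinearMap.congr_fun hL (η z)).symm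
  rw [h1]
  exact L.toContinuousLinearMap.contDiff.contDiffAt.comp y
    (contDiffAt_pi.2 fun r => h _)

theorem contDiffAt_alt_apply {k : ℕ} {F G : Type*} [NormedAddCommGroup F]
    [NormedSpace ℝ F] [FiniteDimensional ℝ F] [NormedAddCommGroup G]
    [NormedSpace ℝ G] {n : WithTop ℕ∞} {η : G → F [⋀^Fin k]→L[ℝ] ℝ} {w : Fin k → G → F} {y : G}
    (h : ContDiffAt ℝ n η y) (hw : ∀ i, ContDiffAt ℝ n (w i) y) :
    ContDiffAt ℝ n (fun z => η z (fun i => w i z)) y := by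
  let b := Module.finBasis ℝ F
  have h1 : ∀ z, η z (fun i => w i z) = ∑ r : Fin k → Fin (Module.finrank ℝ F),
      (∏ i, b.equivFunL (w i z) (r i)) * η z (fun i => b (r i)) := by
    intro z
    conv_lhs => rw [show (fun i => w i z) = fun i => ∑ j, b.equivFun (w i z) j • b j from
      funext fun i => (b.sum_equivFun (w i z)).symm]
    change (η z).toMultilinearMap _ = _
    rw [MultilinearMap.map_sum]
    exact Finset.sum_congr rfl fun r _ => (η z).toMultilinearMap.map_smul_univ _ _
  simp_rw [h1]
  refine ContDiffAt.sum fun r _ => ContDiffAt.mul (contDiffAt_prod fun i _ => ?_) ?_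
  · exact (contDiffAt_pi.1 (b.equivFunL.contDiff.contDiffAt.comp y (hw i))) (r i)
  · exact (ContinuousAlternatingMap.apply ℝ F ℝ (fun i => b (r i))).contDiff.contDiffAt.comp y h

theorem contDiffAt_pullback {k : ℕ} {F G : Type*} [NormedAddCommGroup F]
    [NormedSpace ℝ F] [FiniteDimensional ℝ F] [NormedAddCommGroup G]
    [NormedSpace ℝ G] {n : WithTop ℕ∞} {η : G → F [⋀^Fin k]→L[ℝ] ℝ} {A : G → E →L[ℝ] F} {y : G}
    (h : ContDiffAt ℝ n η y) (hA : ContDiffAt ℝ n A y) :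
    ContDiffAt ℝ n (fun z => (η z).compContinuousLinearMap (A z)) y :=
  contDiffAt_alt_of_apply fun v =>
    contDiffAt_alt_apply (w := fun i z => A z (v i)) h fun _ => hA.clm_apply contDiffAt_const

end Calculus

/-! ### Changes of charts and the exterior derivative -/

section Charts

open ContinuousAlternatingMap Filter Topology

variable {E : Type*} [NormedAddCommGroup E] [NormedSpace ℝ E]
  {M : Type*} [TopologicalSpace M] [ChartedSpace E M] [IsManifold 𝓘(ℝ, E) ∞ M]

theorem toModel_ofModel {x z : M} (hz : z ∈ (extChartAt 𝓘(ℝ, E) x).source) (v : E) :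
    toModel x z (ofModel x z v) = v := by
  rw [extChartAt_source] at hz
  exact Bundle.Trivialization.continuousLinearMapAt_symmL _ hz v

theorem ofModel_toModel {x z : M} (hz : z ∈ (extChartAt 𝓘(ℝ, E) x).source)
    (v : TangentSpace 𝓘(ℝ, E) z) : ofModel x z (toModel x z v) = v := by
  rw [extChartAt_source] at hz
  exact Bundle.Trivialization.symmL_continuousLinearMapAt _ hz v

theorem toModel_comp_ofModel {x z : M} (hz : z ∈ (extChartAt 𝓘(ℝ, E) x).source) :
    toModel x z ∘L ofModel x z = ContinuousLinearMap.id ℝ E :=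
  ContinuousLinearMap.ext (toModel_ofModel hz)

theorem ofModel_comp_toModel {x z : M} (hz : z ∈ (extChartAt 𝓘(ℝ, E) x).source) :
    ofModel x z ∘L toModel x z = ContinuousLinearMap.id ℝ (TangentSpace 𝓘(ℝ, E) z) :=
  ContinuousLinearMap.ext (ofModel_toModel hz)

variable (E) in
/-- The transition map from the chart centred at `x` to the chart centred at `z`. -/
abbrev trans (x z : M) : E → E := extChartAt 𝓘(ℝ, E) z ∘ (extChartAt 𝓘(ℝ, E) x).symm

/-- The cocycle of the tangent bundle is the derivative of the transition map. This ties the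
trivialisations used in the definitions to calculus in charts. -/
theorem toModel_comp_ofModel_eq_fderiv {x z w : M} (hx : w ∈ (extChartAt 𝓘(ℝ, E) x).source)
    (hz : w ∈ (extChartAt 𝓘(ℝ, E) z).source) :
    toModel z w ∘L ofModel x w = fderiv ℝ (trans E x z) (extChartAt 𝓘(ℝ, E) x w) := by
  have : IsManifold 𝓘(ℝ, E) 1 M := IsManifold.of_le (n := ∞) (by simp)
  ext v
  have h := tangentCoordChange_comp (I := 𝓘(ℝ, E)) (w := x) (x := w) (y := z) (z := w) (v := v)
    ⟨⟨hx, mem_extChartAt_source w⟩, hz⟩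
  rw [tangentCoordChange_def (x := x) (y := z), modelWithCornersSelf_coe, Set.range_id,
    fderivWithin_univ] at h
  rw [extChartAt_source] at hx hz
  rw [trans, ← h, ContinuousLinearMap.comp_apply, toModel, ofModel,
    TangentBundle.continuousLinearMapAt_trivializationAt_eq_core hz,
    TangentBundle.symmL_trivializationAt_eq_core hx]
  rfl

theorem contDiffAt_trans {x z w : M} (hx : w ∈ (extChartAt 𝓘(ℝ, E) x).source)
    (hz : w ∈ (extChartAt 𝓘(ℝ, E) z).source) :
    ContDiffAt ℝ ∞ (trans E x z) (extChartAt 𝓘(ℝ, E) x w) := by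
  have h := contDiffWithinAt_ext_coord_change (I := 𝓘(ℝ, E)) (n := ∞) z x
    (y := extChartAt 𝓘(ℝ, E) x w) (by
      rw [PartialEquiv.trans_source'', PartialEquiv.symm_symm, PartialEquiv.symm_target]
      exact Set.mem_image_of_mem _ ⟨hx, hz⟩)
  rwa [modelWithCornersSelf_coe, Set.range_id, contDiffWithinAt_univ] at h

theorem tendsto_unchart {x z : M} (hz : z ∈ (extChartAt 𝓘(ℝ, E) x).source) :
    Tendsto (unchart (E := E) x) (𝓝 (extChartAt 𝓘(ℝ, E) x z)) (𝓝 z) := by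
  have h := continuousAt_extChartAt_symm' (I := 𝓘(ℝ, E)) hz
  rw [ContinuousAt, (extChartAt 𝓘(ℝ, E) x).left_inv hz] at h
  exact h

theorem tendsto_unchart_pt (x : M) : Tendsto (unchart (E := E) x) (𝓝 (pt x)) (𝓝 x) :=
  tendsto_unchart (mem_extChartAt_source x)

/-- Turns statements about coordinates y near a point into statements about points w of M, where the
`rep_chart` lemmas apply. -/
theorem eventually_unchart {x z : M} (hz : z ∈ (extChartAt 𝓘(ℝ, E) x).source) {p : E → M → Prop}
    (h : ∀ᶠ w in 𝓝 z, w ∈ (extChartAt 𝓘(ℝ, E) x).source → p (extChartAt 𝓘(ℝ, E) x w) w) :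
    ∀ᶠ y in 𝓝 (extChartAt 𝓘(ℝ, E) x z), p y (unchart x y) := by
  have ht : (extChartAt 𝓘(ℝ, E) x).target ∈ 𝓝 (extChartAt 𝓘(ℝ, E) x z) :=
    (isOpen_extChartAt_target x).mem_nhds ((extChartAt 𝓘(ℝ, E) x).map_source hz)
  filter_upwards [(tendsto_unchart hz).eventually h, ht] with y hy hty
  have := hy ((extChartAt 𝓘(ℝ, E) x).map_target hty)
  rwa [(extChartAt 𝓘(ℝ, E) x).right_inv hty] at this

theorem eventually_unchart_pt {x : M} {p : E → M → Prop}
    (h : ∀ᶠ w in 𝓝 x, w ∈ (extChartAt 𝓘(ℝ, E) x).source → p (extChartAt 𝓘(ℝ, E) x w) w) :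
    ∀ᶠ y in 𝓝 (pt x), p y (unchart x y) :=
  eventually_unchart (mem_extChartAt_source x) h

theorem two_le_infty : minSmoothness ℝ 2 ≤ ∞ := by
  rw [minSmoothness_of_isRCLikeNormedField]
  exact WithTop.coe_le_coe.2 (le_top (a := (2 : ℕ∞)))

theorem comp_comp {F G H : Type*} [AddCommGroup F] [Module ℝ F] [TopologicalSpace F]
    [AddCommGroup G] [Module ℝ G] [TopologicalSpace G] [AddCommGroup H] [Module ℝ H]
    [TopologicalSpace H] {k : ℕ} (γ : F [⋀^Fin k]→L[ℝ] ℝ) (f : G →L[ℝ] F) (g : H →L[ℝ] G) :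
    (γ.compContinuousLinearMap f).compContinuousLinearMap g =
      γ.compContinuousLinearMap (f ∘L g) := rfl

theorem comp_id {F : Type*} [AddCommGroup F] [Module ℝ F] [TopologicalSpace F]
    {k : ℕ} (γ : F [⋀^Fin k]→L[ℝ] ℝ) :
    γ.compContinuousLinearMap (ContinuousLinearMap.id ℝ F) = γ := rfl

variable [FiniteDimensional ℝ E]

theorem DForm.rep_chart {k : ℕ} (η : DForm E M k) {x w : M}
    (hw : w ∈ (extChartAt 𝓘(ℝ, E) x).source) :
    η.rep x (extChartAt 𝓘(ℝ, E) x w) = (η w).compContinuousLinearMap (ofModel x w) := by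
  rw [DForm.rep, unchart, (extChartAt 𝓘(ℝ, E) x).left_inv hw]

theorem vecRep_chart (X : ∀ x : M, TangentSpace 𝓘(ℝ, E) x) {x w : M}
    (hw : w ∈ (extChartAt 𝓘(ℝ, E) x).source) :
    vecRep X x (extChartAt 𝓘(ℝ, E) x w) = toModel x w (X w) := by
  rw [vecRep, unchart, (extChartAt 𝓘(ℝ, E) x).left_inv hw]

theorem MVField.rep_chart {p : ℕ} (U : MVField E M p) {x w : M}
    (hw : w ∈ (extChartAt 𝓘(ℝ, E) x).source) (γ : E [⋀^Fin p]→L[ℝ] ℝ) :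
    U.rep x (extChartAt 𝓘(ℝ, E) x w) γ = U w (γ.compContinuousLinearMap (toModel x w)) := by
  rw [MVField.rep, unchart, (extChartAt 𝓘(ℝ, E) x).left_inv hw]
  rfl

theorem MVForm.rep_chart {a p : ℕ} (Ψ : MVForm E M a p) {x w : M}
    (hw : w ∈ (extChartAt 𝓘(ℝ, E) x).source) (γ : E [⋀^Fin p]→L[ℝ] ℝ) :
    Ψ.rep x (extChartAt 𝓘(ℝ, E) x w) γ =
      (opEquiv (Ψ w) (γ.compContinuousLinearMap (toModel x w))).compContinuousLinearMap
        (ofModel x w) := by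
  rw [MVForm.rep, unchart, (extChartAt 𝓘(ℝ, E) x).left_inv hw]
  rfl

theorem DForm.rep_congr {k : ℕ} {η η' : DForm E M k} {x : M} (h : ∀ᶠ z in 𝓝 x, η z = η' z) :
    η.rep x =ᶠ[𝓝 (pt x)] η'.rep x := by
  filter_upwards [(tendsto_unchart_pt x).eventually h] with y hy
  rw [DForm.rep, DForm.rep, hy]

theorem MVField.rep_congr {p : ℕ} {U U' : MVField E M p} {x : M} (h : ∀ᶠ z in 𝓝 x, U z = U' z) :
    U.rep x =ᶠ[𝓝 (pt x)] U'.rep x := by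
  filter_upwards [(tendsto_unchart_pt x).eventually h] with y hy
  rw [MVField.rep, MVField.rep, hy]

theorem extD_congr {k : ℕ} {η η' : DForm E M k} {x : M} (h : ∀ᶠ z in 𝓝 x, η z = η' z) :
    extD η x = extD η' x := by
  rw [extD, extD, (DForm.rep_congr h).extDeriv_eq]

theorem extD_smul {k : ℕ} (c : ℝ) (η : DForm E M k) : extD (c • η) = c • extD η := by
  ext1 x
  have h : DForm.rep (c • η) x = c • η.rep x := rfl
  rw [extD, h, extDeriv_smul]
  rfl

/-- The change of the local representation of a form under a change of charts. -/
theorem DForm.rep_trans {k : ℕ} (η : DForm E M k) {x z : M}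
    (hz : z ∈ (extChartAt 𝓘(ℝ, E) x).source) :
    η.rep x =ᶠ[𝓝 (extChartAt 𝓘(ℝ, E) x z)] fun y =>
      (η.rep z (trans E x z y)).compContinuousLinearMap (fderiv ℝ (trans E x z) y) := by
  refine eventually_unchart (p := fun y _ => η.rep x y = (η.rep z
    (trans E x z y)).compContinuousLinearMap (fderiv ℝ (trans E x z) y)) hz ?_
  filter_upwards [extChartAt_source_mem_nhds (I := 𝓘(ℝ, E)) z] with w hzw hxw
  rw [η.rep_chart hxw, ← toModel_comp_ofModel_eq_fderiv hxw hzw, trans, Function.comp_apply,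
    (extChartAt 𝓘(ℝ, E) x).left_inv hxw, η.rep_chart hzw, comp_comp,
    ← ContinuousLinearMap.comp_assoc, ofModel_comp_toModel hzw, ContinuousLinearMap.id_comp]

theorem trans_chart {x z : M} (hz : z ∈ (extChartAt 𝓘(ℝ, E) x).source) :
    trans E x z (extChartAt 𝓘(ℝ, E) x z) = pt z := by
  rw [trans, Function.comp_apply, (extChartAt 𝓘(ℝ, E) x).left_inv hz]

/-- Smoothness at z is defined in the chart centred at z; by the transition rule it can be read off
in any chart around z. -/
theorem DForm.contDiffAt_rep {k : ℕ} {η : DForm E M k} {x z : M}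
    (hz : z ∈ (extChartAt 𝓘(ℝ, E) x).source) (hη : ContDiffAt ℝ ∞ (η.rep z) (pt z)) :
    ContDiffAt ℝ ∞ (η.rep x) (extChartAt 𝓘(ℝ, E) x z) := by
  have ht := contDiffAt_trans (E := E) hz (mem_extChartAt_source z)
  rw [← trans_chart hz] at hη
  exact (contDiffAt_pullback (hη.comp _ ht)
    (ht.fderiv_right (m := ∞) (by simp))).congr_of_eventuallyEq (η.rep_trans hz)

/-- `extD` uses a different chart at every point. Since d commutes with pull-back along the
transition map, one fixed chart computes it at all nearby points, so that it can be differentiated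
again. -/
theorem extD_rep_chart {k : ℕ} {η : DForm E M k} {x z : M}
    (hz : z ∈ (extChartAt 𝓘(ℝ, E) x).source) (hη : ContDiffAt ℝ ∞ (η.rep z) (pt z)) :
    (extD η).rep x (extChartAt 𝓘(ℝ, E) x z) = extDeriv (η.rep x) (extChartAt 𝓘(ℝ, E) x z) := by
  have ht := contDiffAt_trans (E := E) hz (mem_extChartAt_source z)
  rw [← trans_chart hz] at hη
  rw [(η.rep_trans hz).extDeriv_eq,
    extDeriv_pullback (hη.differentiableAt (by simp)) ht two_le_infty,
    trans_chart hz, ← toModel_comp_ofModel_eq_fderiv hz (mem_extChartAt_source z),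
    DForm.rep_chart _ hz, extD, comp_comp]

theorem extD_rep {k : ℕ} {η : DForm E M k} {O : Set M} (hO : IsOpen O) (hη : η.SmoothOn O)
    {x : M} (hx : x ∈ O) : (extD η).rep x =ᶠ[𝓝 (pt x)] extDeriv (η.rep x) := by
  refine eventually_unchart_pt (p := fun y _ => (extD η).rep x y = extDeriv (η.rep x) y) ?_
  filter_upwards [hO.mem_nhds hx] with z hz hxz
  exact extD_rep_chart hxz (hη z hz)

theorem contDiffAt_extDeriv {k : ℕ} {η : E → E [⋀^Fin k]→L[ℝ] ℝ} {y : E}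
    (hη : ContDiffAt ℝ ∞ η y) : ContDiffAt ℝ ∞ (extDeriv η) y := by
  have h := hη.fderiv_right (m := ∞) (by simp)
  exact ContDiffAt.comp y (g := alternatizeUncurryFinCLM ℝ E ℝ) (by fun_prop) h

theorem DForm.SmoothOn.extD {k : ℕ} {η : DForm E M k} {O : Set M} (hO : IsOpen O)
    (hη : η.SmoothOn O) : (extD η).SmoothOn O := fun x hx =>
  (contDiffAt_extDeriv (hη x hx)).congr_of_eventuallyEq (extD_rep hO hη hx)

theorem extD_extD {k : ℕ} {η : DForm E M k} {O : Set M} (hO : IsOpen O)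
    (hη : η.SmoothOn O) {x : M} (hx : x ∈ O) : GDirac.extD (GDirac.extD η) x = 0 := by
  rw [GDirac.extD, (extD_rep hO hη hx).extDeriv_eq, extDeriv_extDeriv_apply (hη x hx) two_le_infty]
  rfl

end Charts

/-! ### Vector fields, contractions and brackets in charts -/

section Fields

open ContinuousAlternatingMap Filter Topology

variable {E : Type*} [NormedAddCommGroup E] [NormedSpace ℝ E]
  {M : Type*} [TopologicalSpace M] [ChartedSpace E M] [IsManifold 𝓘(ℝ, E) ∞ M]
  [FiniteDimensional ℝ E]

/-- The `1`-vector field given by a vector field. -/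
def vecField (X : ∀ x : M, TangentSpace 𝓘(ℝ, E) x) : MVField E M 1 := fun x => ofVec (X x)

theorem contract_ofVec_cons {k : ℕ} {x : M} (h : 1 + k = k + 1) (v : TangentSpace 𝓘(ℝ, E) x)
    (η : TangentSpace 𝓘(ℝ, E) x [⋀^Fin (k + 1)]→L[ℝ] ℝ) (w : Fin k → TangentSpace 𝓘(ℝ, E) x) :
    contract h (ofVec v) η w = η (Matrix.vecCons v w) :=
  contract_ofVec_apply h rfl v η w

theorem contract_comp_ofModel {k : ℕ} {x z : M} (hz : z ∈ (extChartAt 𝓘(ℝ, E) x).source)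
    (h : 1 + k = k + 1) (v : TangentSpace 𝓘(ℝ, E) z)
    (η : TangentSpace 𝓘(ℝ, E) z [⋀^Fin (k + 1)]→L[ℝ] ℝ) :
    (contract h (ofVec v) η).compContinuousLinearMap (ofModel x z) =
      (η.compContinuousLinearMap (ofModel x z)).curryLeft (toModel x z v) := by
  ext w
  rw [compContinuousLinearMap_apply, contract_ofVec_cons, curryLeft_apply_apply,
    compContinuousLinearMap_apply]
  congr 1
  ext i
  refine Fin.cases ?_ (fun i => ?_) i
  · simp [ofModel_toModel hz]
  · simp

theorem contract_comp_toModel {k : ℕ} {x z : M} (h : 1 + k = k + 1) (v : TangentSpace 𝓘(ℝ, E) z) (η : E [⋀^Fin (k + 1)]→L[ℝ] ℝ) :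
    contract h (ofVec v) (η.compContinuousLinearMap (toModel x z)) =
      (η.curryLeft (toModel x z v)).compContinuousLinearMap (toModel x z) := by
  ext w
  rw [compContinuousLinearMap_apply, contract_ofVec_cons, curryLeft_apply_apply,
    compContinuousLinearMap_apply]
  congr 1
  ext i
  refine Fin.cases ?_ (fun i => ?_) i <;> simp

theorem contr_rep {k : ℕ} (h : 1 + k = k + 1) (X : ∀ x : M, TangentSpace 𝓘(ℝ, E) x)
    (η : DForm E M (k + 1)) (x : M) :
    (contr h (vecField X) η).rep x =ᶠ[𝓝 (pt x)] fun y => (η.rep x y).curryLeft (vecRep X x y) := by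
  refine eventually_unchart_pt (p := fun y _ => (contr h (vecField X) η).rep x y =
    (η.rep x y).curryLeft (vecRep X x y)) ?_
  refine Eventually.of_forall fun z hxz => ?_
  rw [DForm.rep_chart _ hxz, DForm.rep_chart _ hxz, vecRep_chart _ hxz]
  exact contract_comp_ofModel hxz h _ _

theorem DForm.SmoothOn.contr {k : ℕ} (h : 1 + k = k + 1) {X : ∀ x : M, TangentSpace 𝓘(ℝ, E) x}
    {η : DForm E M (k + 1)} {O : Set M} (hX : VecSmoothOn X O) (hη : η.SmoothOn O) :
    (GDirac.contr h (vecField X) η).SmoothOn O := fun x hx =>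
  (contDiffAt_curry (hη x hx) (hX x hx)).congr_of_eventuallyEq (contr_rep h X η x)

theorem comp_toModel_comp_ofModel {k : ℕ} {x z : M} (hz : z ∈ (extChartAt 𝓘(ℝ, E) x).source)
    (η : E [⋀^Fin k]→L[ℝ] ℝ) :
    (η.compContinuousLinearMap (toModel x z)).compContinuousLinearMap (ofModel x z) = η := by
  rw [comp_comp, toModel_comp_ofModel hz, comp_id]

theorem comp_ofModel_comp_toModel {k : ℕ} {x z : M} (hz : z ∈ (extChartAt 𝓘(ℝ, E) x).source)
    (η : TangentSpace 𝓘(ℝ, E) z [⋀^Fin k]→L[ℝ] ℝ) :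
    (η.compContinuousLinearMap (ofModel x z)).compContinuousLinearMap (toModel x z) = η := by
  rw [comp_comp, ofModel_comp_toModel hz, comp_id]

theorem rep_pt {k : ℕ} (η : DForm E M k) (x : M) :
    η.rep x (pt x) = (η x).compContinuousLinearMap (ofModel x x) :=
  η.rep_chart (mem_extChartAt_source x)

/-- Cartan's formula on a manifold. -/
theorem extD_contr_add {k : ℕ} {X : ∀ x : M, TangentSpace 𝓘(ℝ, E) x} {η : DForm E M (k + 1)}
    {x : M} (hX : ContDiffAt ℝ ∞ (vecRep X x) (pt x)) (hη : ContDiffAt ℝ ∞ (η.rep x) (pt x))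
    (h : 1 + k = k + 1) (h' : 1 + (k + 1) = k + 1 + 1) :
    extD (contr h (vecField X) η) x + contr h' (vecField X) (extD η) x =
      (flatLie (vecRep X x) (η.rep x) (pt x)).compContinuousLinearMap (toModel x x) := by
  rw [← extDeriv_curry_add (hη.differentiableAt (by simp)) (hX.differentiableAt (by simp)), extD,
    (contr_rep h X η x).extDeriv_eq]
  have h1 : contr h' (vecField X) (extD η) x =
      ((extDeriv (η.rep x) (pt x)).curryLeft (vecRep X x (pt x))).compContinuousLinearMap
        (toModel x x) := by
    rw [vecRep_chart _ (mem_extChartAt_source x)]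
    exact contract_comp_toModel h' _ _
  rw [h1]
  rfl

theorem ofVec_comp {F G : Type*} [AddCommGroup F] [Module ℝ F] [TopologicalSpace F]
    [IsTopologicalAddGroup F] [ContinuousSMul ℝ F] [AddCommGroup G] [Module ℝ G]
    [TopologicalSpace G] [IsTopologicalAddGroup G] [ContinuousSMul ℝ G] (f : F →L[ℝ] G) (v : F)
    (η : G [⋀^Fin 1]→L[ℝ] ℝ) : ofVec v (η.compContinuousLinearMap f) = ofVec (f v) η := rfl

theorem vecField_rep_apply (X : ∀ x : M, TangentSpace 𝓘(ℝ, E) x) (x : M) (y : E)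
    (γ : E [⋀^Fin 1]→L[ℝ] ℝ) : (vecField X).rep x y γ = γ (fun _ => vecRep X x y) := rfl

theorem vecRep_toVec (U : MVField E M 1) (x : M) (y : E) :
    vecRep (fun z => toVec (U z)) x y = toVec (U.rep x y : (E [⋀^Fin 1]→L[ℝ] ℝ) →ₗ[ℝ] ℝ) := by
  refine ofVec_injective ?_
  rw [ofVec_toVec]
  ext γ
  rw [vecRep, ← ofVec_comp, ofVec_toVec]
  rfl

/-- `toVec` on the continuous dual, as a linear map. -/
def toVecDual : ((E [⋀^Fin 1]→L[ℝ] ℝ) →L[ℝ] ℝ) →ₗ[ℝ] E where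
  toFun u := toVec (u : (E [⋀^Fin 1]→L[ℝ] ℝ) →ₗ[ℝ] ℝ)
  map_add' u u' := map_add toVec (u : (E [⋀^Fin 1]→L[ℝ] ℝ) →ₗ[ℝ] ℝ) u'
  map_smul' c u := map_smul toVec c (u : (E [⋀^Fin 1]→L[ℝ] ℝ) →ₗ[ℝ] ℝ)

/-- `toVec` on the continuous dual, as a continuous linear map. -/
def toVecCLM : ((E [⋀^Fin 1]→L[ℝ] ℝ) →L[ℝ] ℝ) →L[ℝ] E :=
  LinearMap.toContinuousLinearMap (𝕜 := ℝ) (E := (E [⋀^Fin 1]→L[ℝ] ℝ) →L[ℝ] ℝ) (F' := E)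
    toVecDual

theorem contDiff_toVecCLM {n : WithTop ℕ∞} : ContDiff ℝ n (toVecCLM (E := E)) := by
  fun_prop

theorem apply_toVecCLM (u : (E [⋀^Fin 1]→L[ℝ] ℝ) →L[ℝ] ℝ) (γ : E [⋀^Fin 1]→L[ℝ] ℝ) :
    γ (fun _ => toVecCLM u) = u γ :=
  LinearMap.congr_fun (ofVec_toVec (u : (E [⋀^Fin 1]→L[ℝ] ℝ) →ₗ[ℝ] ℝ)) γ

theorem MVField.SmoothOn.toVec {U : MVField E M 1} {O : Set M} (hU : U.SmoothOn O) :
    VecSmoothOn (fun z => toVec (U z)) O := by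
  intro x hx
  have h : vecRep (fun z => GDirac.toVec (U z)) x = fun y => toVecCLM (U.rep x y) :=
    funext (vecRep_toVec U x)
  rw [h]
  exact (contDiff_toVecCLM (E := E)).contDiffAt.comp _ (hU x hx)

theorem vecField_toVec (U : MVField E M 1) : vecField (fun z => toVec (U z)) = U :=
  funext fun _ => ofVec_toVec _

/-- `ofVec` with values in the continuous dual, as a linear map. -/
def ofVecDual : E →ₗ[ℝ] ((E [⋀^Fin 1]→L[ℝ] ℝ) →L[ℝ] ℝ) where
  toFun v := LinearMap.toContinuousLinearMap (ofVecLin v)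
  map_add' v w := by rw [map_add, map_add]
  map_smul' c v := by rw [map_smul, map_smul, RingHom.id_apply]

/-- `ofVec` with values in the continuous dual, as a continuous linear map. -/
def ofVecCLM : E →L[ℝ] ((E [⋀^Fin 1]→L[ℝ] ℝ) →L[ℝ] ℝ) :=
  LinearMap.toContinuousLinearMap (𝕜 := ℝ) (E := E) (F' := (E [⋀^Fin 1]→L[ℝ] ℝ) →L[ℝ] ℝ)
    ofVecDual

theorem contDiff_ofVecCLM {n : WithTop ℕ∞} : ContDiff ℝ n (ofVecCLM (E := E)) := by
  fun_prop

theorem vecField_rep (X : ∀ x : M, TangentSpace 𝓘(ℝ, E) x) (x : M) :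
    (vecField X).rep x = fun y => ofVecCLM (vecRep X x y) := rfl

theorem VecSmoothOn.vecField {X : ∀ x : M, TangentSpace 𝓘(ℝ, E) x} {O : Set M}
    (hX : VecSmoothOn X O) : (vecField X).SmoothOn O := by
  intro x hx
  rw [vecField_rep]
  exact (contDiff_ofVecCLM (E := E)).contDiffAt.comp _ (hX x hx)

/-- For constant γ, ι_Y γ is the function γ(Y), whose derivative along X is γ(DY·X). -/
theorem dContrConst_vecField {X Y : ∀ x : M, TangentSpace 𝓘(ℝ, E) x} {x : M}
    (hY : DifferentiableAt ℝ (vecRep Y x) (pt x)) (h : (0 + 1) + 0 = 1)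
    (γ : E [⋀^Fin 1]→L[ℝ] ℝ) :
    dContrConst (p := 0) (q := 0) h ((vecField X).rep x) ((vecField Y).rep x) (pt x) γ =
      γ (fun _ => fderiv ℝ (vecRep Y x) (pt x) (vecRep X x (pt x))) := by
  let B₀ : E →ₗ[ℝ] (E [⋀^Fin 1]→L[ℝ] ℝ) →L[ℝ] (E [⋀^Fin 0]→L[ℝ] ℝ) :=
    { toFun := fun v => LinearMap.toContinuousLinearMap (contractForms h (ofVecLin v))
      map_add' := fun v w => by rw [map_add]; rfl
      map_smul' := fun c v => by rw [map_smul]; rfl }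
  let B : E →L[ℝ] (E [⋀^Fin 1]→L[ℝ] ℝ) →L[ℝ] (E [⋀^Fin 0]→L[ℝ] ℝ) :=
    LinearMap.toContinuousLinearMap (𝕜 := ℝ) (E := E)
      (F' := (E [⋀^Fin 1]→L[ℝ] ℝ) →L[ℝ] (E [⋀^Fin 0]→L[ℝ] ℝ)) B₀
  have hB : ∀ v, HasFDerivAt B B v := fun v => by
    exact ContinuousLinearMap.hasFDerivAt
      (F := (E [⋀^Fin 1]→L[ℝ] ℝ) →L[ℝ] (E [⋀^Fin 0]→L[ℝ] ℝ)) B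
  have hfun : (fun z => LinearMap.toContinuousLinearMap (contractForms h
      ((vecField Y).rep x z : (E [⋀^Fin 1]→L[ℝ] ℝ) →ₗ[ℝ] ℝ))) = B ∘ vecRep Y x := rfl
  have h1 : fderiv ℝ (B ∘ vecRep Y x) (pt x) = B ∘L fderiv ℝ (vecRep Y x) (pt x) := by
    have h2 := hY.hasFDerivAt
    generalize fderiv ℝ (vecRep Y x) (pt x) = A at *
    exact (HasFDerivAt.comp (G := (E [⋀^Fin 1]→L[ℝ] ℝ) →L[ℝ] (E [⋀^Fin 0]→L[ℝ] ℝ)) (g := B)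
      (g' := B) (pt x) (hB _) h2).fderiv
  rw [dContrConst, hfun, h1]
  change (vecField X).rep x (pt x) (alternatizeUncurryFin
    ((B ∘L fderiv ℝ (vecRep Y x) (pt x)).flip γ)) = _
  rw [vecField_rep_apply, alternatizeUncurryFin_apply, Fin.sum_univ_one]
  rw [Fin.val_zero, pow_zero, one_smul]
  change contract h (ofVec (fderiv ℝ (vecRep Y x) (pt x) (vecRep X x (pt x)))) γ _ = _
  rw [contract_apply, ofVec_apply, fixLast_apply]
  congr 1
  ext i
  rw [Subsingleton.elim i 0]
  rfl

/-- On vector fields the Schouten bracket is the Lie bracket. -/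
theorem schouten_vecField {X Y : ∀ x : M, TangentSpace 𝓘(ℝ, E) x} {x : M}
    (hX : DifferentiableAt ℝ (vecRep X x) (pt x)) (hY : DifferentiableAt ℝ (vecRep Y x) (pt x)) :
    schouten (p := 0) (q := 0) (vecField X) (vecField Y) x =
      ofVec (ofModel x x (VectorField.lieBracket ℝ (vecRep X x) (vecRep Y x) (pt x))) := by
  ext γ
  have h1 := dContrConst_vecField (X := X) hY rfl (γ.compContinuousLinearMap (ofModel x x))
  have h2 := dContrConst_vecField (X := Y) hX rfl (γ.compContinuousLinearMap (ofModel x x))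
  have h3 : schouten (p := 0) (q := 0) (vecField X) (vecField Y) x γ =
      (-1 : ℝ) ^ (0 * 0) * dContrConst (p := 0) (q := 0) rfl ((vecField X).rep x)
        ((vecField Y).rep x) (pt x) (γ.compContinuousLinearMap (ofModel x x)) -
      dContrConst (p := 0) (q := 0) rfl ((vecField Y).rep x) ((vecField X).rep x) (pt x)
        (γ.compContinuousLinearMap (ofModel x x)) := rfl
  rw [h3, h1, h2, mul_zero, pow_zero, one_mul, VectorField.lieBracket_eq, ← ofVec_comp]
  exact (map_sub (LinearMap.flip ofVecLin (γ.compContinuousLinearMap (ofModel x x))) _ _).symm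

end Fields

/-! ### Cut-off functions and locality -/

section Cutoff

open ContinuousAlternatingMap Filter Topology

variable {E : Type*} [NormedAddCommGroup E] [NormedSpace ℝ E] [FiniteDimensional ℝ E]
  {M : Type*} [TopologicalSpace M] [ChartedSpace E M] [IsManifold 𝓘(ℝ, E) ∞ M]

/-- A smooth function supported in `O` that is `1` near `x`. -/
theorem exists_cutoff [T2Space M] {O : Set M} (hO : IsOpen O) {x : M} (hx : x ∈ O) :
    ∃ χ : M → ℝ, (∀ z, ContDiffAt ℝ ∞ (fun y => χ (unchart (E := E) z y)) (pt z)) ∧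
      (∀ᶠ z in 𝓝 x, χ z = 1) ∧ ∀ z ∉ O, ∀ᶠ w in 𝓝 z, χ w = 0 := by
  obtain ⟨f, -, hf⟩ := (SmoothBumpFunction.nhds_basis_tsupport (I := 𝓘(ℝ, E)) x).mem_iff.1
    (hO.mem_nhds hx)
  refine ⟨f, fun z => ?_, f.eventuallyEq_one, fun z hz => ?_⟩
  · have h := (contMDiffAt_iff (I := 𝓘(ℝ, E)) (I' := 𝓘(ℝ, ℝ))).1 (f.contMDiffAt (x := z))
    have h2 := h.2
    rw [modelWithCornersSelf_coe, Set.range_id, contDiffWithinAt_univ] at h2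
    exact h2
  · exact notMem_tsupport_iff_eventuallyEq.1 fun h => hz (hf h)

/-- At a point outside O the product vanishes on a whole neighbourhood, so f needs no regularity
there. -/
theorem contDiffAt_smul_cutoff {F : Type*} [NormedAddCommGroup F] [NormedSpace ℝ F] {O : Set M}
    {χ : M → ℝ} (hχ : ∀ z, ContDiffAt ℝ ∞ (fun y => χ (unchart (E := E) z y)) (pt z))
    (hχO : ∀ z ∉ O, ∀ᶠ w in 𝓝 z, χ w = 0) {z : M} {f : E → F}
    (hf : z ∈ O → ContDiffAt ℝ ∞ f (pt z)) :
    ContDiffAt ℝ ∞ (fun y => χ (unchart z y) • f y) (pt z) := by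
  by_cases hz : z ∈ O
  · exact (hχ z).smul (hf hz)
  · refine (contDiffAt_const (c := (0 : F))).congr_of_eventuallyEq ?_
    filter_upwards [(tendsto_unchart_pt z).eventually (hχO z hz)] with y hy
    rw [hy, zero_smul]

theorem dContrConst_congr {p q r : ℕ} (h : (q + 1) + p = r)
    {U U' : E → (E [⋀^Fin (p + 1)]→L[ℝ] ℝ) →L[ℝ] ℝ} {V V' : E → (E [⋀^Fin (q + 1)]→L[ℝ] ℝ) →L[ℝ] ℝ}
    {y : E} (hU : U =ᶠ[𝓝 y] U') (hV : V =ᶠ[𝓝 y] V') :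
    dContrConst h U V y = dContrConst h U' V' y := by
  have h1 : (fun z => LinearMap.toContinuousLinearMap
      (contractForms h (V z : (E [⋀^Fin (q + 1)]→L[ℝ] ℝ) →ₗ[ℝ] ℝ))) =ᶠ[𝓝 y]
      fun z => LinearMap.toContinuousLinearMap
      (contractForms h (V' z : (E [⋀^Fin (q + 1)]→L[ℝ] ℝ) →ₗ[ℝ] ℝ)) := by
    filter_upwards [hV] with z hz
    rw [hz]
  rw [dContrConst, dContrConst, h1.fderiv_eq, hU.eq_of_nhds]

theorem schouten_congr {p q : ℕ} {U U' : MVField E M (p + 1)} {V V' : MVField E M (q + 1)} {x : M}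
    (hU : ∀ᶠ z in 𝓝 x, U z = U' z) (hV : ∀ᶠ z in 𝓝 x, V z = V' z) :
    schouten U V x = schouten U' V' x := by
  rw [schouten, schouten, dContrConst_congr _ (MVField.rep_congr hU) (MVField.rep_congr hV),
    dContrConst_congr _ (MVField.rep_congr hV) (MVField.rep_congr hU)]

theorem contract_zero {V : Type*} [AddCommGroup V] [Module ℝ V] [TopologicalSpace V]
    [IsTopologicalAddGroup V] [ContinuousSMul ℝ V] [T2Space V] [FiniteDimensional ℝ V]
    {p k m : ℕ} (h : p + k = m) (U : MultiVec p V) : contract h U 0 = 0 :=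
  map_zero (contractForms h U)

theorem sub_neg_one_smul {V : Type*} [AddCommGroup V] [Module ℝ V] (u v : V) :
    u - (-1 : ℝ) ^ (0 + 1) • v = u + v := by
  simp

end Cutoff

/-! ### Integrability along a closed section of S^n -/

namespace GradedDirac

open Filter Topology

variable {E : Type*} [NormedAddCommGroup E] [NormedSpace ℝ E] [FiniteDimensional ℝ E]
  {M : Type*} [TopologicalSpace M] [ChartedSpace E M] [IsManifold 𝓘(ℝ, E) ∞ M]

/-- The Lie derivative at `x` of a form along a vector field. -/
def lieAt {k : ℕ} (X : ∀ x : M, TangentSpace 𝓘(ℝ, E) x) (β : DForm E M k) (x : M) :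
    TangentSpace 𝓘(ℝ, E) x [⋀^Fin k]→L[ℝ] ℝ :=
  (flatLie (vecRep X x) (β.rep x) (pt x)).compContinuousLinearMap (toModel x x)

/-- `U` represents `♯_a(α)` on `O`. -/
def Rep {n : ℕ} (D : GradedDirac E M n) {a p : ℕ} (h : a + p = n + 1) (O : Set M)
    (α : DForm E M a) (U : MVField E M p) : Prop :=
  ∀ z ∈ O, ∃ hz : α z ∈ D.S a z, Submodule.Quotient.mk (U z) = D.sharp a p h z ⟨α z, hz⟩

/-- ♯ is linear in each fibre; outside O both sides are zero, even where α does not lie in S^a. -/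
theorem Rep.smul_cutoff {n : ℕ} {D : GradedDirac E M n} {a p : ℕ} {h : a + p = n + 1} {O : Set M}
    {α : DForm E M a} {U : MVField E M p} (hr : D.Rep h O α U) {χ : M → ℝ}
    (hχ : ∀ z ∉ O, χ z = 0) :
    D.Rep h Set.univ (fun z => χ z • α z) (fun z => χ z • U z) := by
  intro z _
  by_cases hz : z ∈ O
  · obtain ⟨h1, h2⟩ := hr z hz
    refine ⟨Submodule.smul_mem _ _ h1, ?_⟩
    rw [Submodule.Quotient.mk_smul, h2, ← map_smul]
    rfl
  · have h0 : χ z • α z = 0 := by rw [hχ z hz, zero_smul]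
    have h1 : χ z • α z ∈ D.S a z := by rw [h0]; exact Submodule.zero_mem _
    refine ⟨h1, ?_⟩
    rw [show (⟨χ z • α z, h1⟩ : D.S a z) = 0 from Subtype.ext h0, map_zero]
    change Submodule.Quotient.mk (χ z • U z) = _
    rw [hχ z hz, zero_smul]
    rfl

/-- The integrability axiom for τ and β. Skew-symmetry makes the two contractions in θ equal up to
the prescribed sign, and closedness of τ gives £_V τ = dι_V τ, so everything but £_X β cancels. -/
theorem lieAt_mem [T2Space M] {m : ℕ} (D : GradedDirac E M (m + 1)) {k q : ℕ} (hkq : k + q = m)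
    {O : Set M} (hO : IsOpen O) {x : M} (hx : x ∈ O) {τ : DForm E M (m + 1)} (hτ : τ.SmoothOn O)
    (hd : extD τ x = 0) {X : ∀ x : M, TangentSpace 𝓘(ℝ, E) x} (hX : VecSmoothOn X O)
    (hXτ : D.Rep rfl O τ (vecField X)) {β : DForm E M (k + 1)} (hβ : β.SmoothOn O)
    {V : MVField E M (q + 1)} (hV : V.SmoothOn O)
    (hVβ : D.Rep (show k + 1 + (q + 1) = m + 1 + 1 by omega) O β V) :
    ∃ h : lieAt X β x ∈ D.S (k + 1) x,
      D.sharp (k + 1) (0 + q + 1) (by omega) x ⟨lieAt X β x, h⟩ =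
        Submodule.Quotient.mk (schouten (p := 0) (vecField X) V x) := by
  -- The axiom speaks of global sections, so the four local ones are multiplied by χ, which changes
  -- nothing near x.
  obtain ⟨χ, hχ, hχ1, hχ0⟩ := exists_cutoff (E := E) hO hx
  have hχ0' : ∀ z ∉ O, χ z = 0 := fun z hz => (hχ0 z hz).self_of_nhds
  let τ' : DForm E M (m + 1) := fun z => χ z • τ z
  let β' : DForm E M (k + 1) := fun z => χ z • β z
  let U' : MVField E M (0 + 1) := fun z => χ z • vecField X z
  let V' : MVField E M (q + 1) := fun z => χ z • V z
  have hτ' : τ'.SmoothOn Set.univ := fun z _ => contDiffAt_smul_cutoff hχ hχ0 (hτ z)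
  have hβ' : β'.SmoothOn Set.univ := fun z _ => contDiffAt_smul_cutoff hχ hχ0 (hβ z)
  have hU' : U'.SmoothOn Set.univ := fun z _ => contDiffAt_smul_cutoff hχ hχ0 (hX.vecField z)
  have hV' : V'.SmoothOn Set.univ := fun z _ => contDiffAt_smul_cutoff hχ hχ0 (hV z)
  have hrτ := hXτ.smul_cutoff hχ0'
  have hrβ := hVβ.smul_cutoff hχ0'
  choose hτS hτr using fun z => hrτ z (Set.mem_univ z)
  choose hβS hβr using fun z => hrβ z (Set.mem_univ z)
  have hpb : (0 + 1) + k = k + 1 := by omega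
  have hqa : (q + 1) + k = m + 1 := by omega
  -- The axiom is indexed by order minus one: 0 stands for the vector field U', q for V' of order q
  -- + 1.
  obtain ⟨hθ, hs⟩ := D.integrable (m + 1) 0 (k + 1) q k rfl (by omega) (by omega) (by omega)
    hpb hqa τ' β' U' V' hτ' hβ' hU' hV' hτS hβS hτr hβr
  have hskew : contr hqa V' τ' + (-1 : ℝ) ^ ((0 + 1) * (q + 1)) • contr hpb U' β' =
      (2 : ℝ) • contr hqa V' τ' := by
    ext1 z
    have h1 := D.skew (m + 1) (0 + 1) (k + 1) (q + 1) k rfl (by omega) (by omega) (by omega)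
      (by omega) (by omega) hpb hqa z ⟨τ' z, hτS z⟩ ⟨β' z, hβS z⟩ (U' z) (V' z) (hτr z) (hβr z)
    change contract hqa (V' z) (τ' z) + (-1 : ℝ) ^ ((0 + 1) * (q + 1)) •
      contract hpb (U' z) (β' z) = (2 : ℝ) • contract hqa (V' z) (τ' z)
    rw [h1, smul_smul, ← mul_pow, neg_one_mul, neg_neg, one_pow, one_smul, two_smul]
  -- Closedness is needed at x only; χτ need not be closed elsewhere.
  have hτd : extD τ' x = 0 := by
    rw [← hd]
    refine extD_congr ?_
    filter_upwards [hχ1] with z hz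
    simp only [τ', hz, one_smul]
  have hβd : extD β' x = extD β x := by
    refine extD_congr ?_
    filter_upwards [hχ1] with z hz
    simp only [β', hz, one_smul]
  have hUx : ∀ᶠ z in 𝓝 x, U' z = vecField X z := by
    filter_upwards [hχ1] with z hz
    simp only [U', hz, one_smul]
  have hVx : ∀ᶠ z in 𝓝 x, V' z = V z := by
    filter_upwards [hχ1] with z hz
    simp only [V', hz, one_smul]
  have hc : extD (contr hpb U' β') x = extD (contr hpb (vecField X) β) x := by
    refine extD_congr ?_
    filter_upwards [hχ1, hUx] with z hz hU
    simp only [contr, hU, β', hz, one_smul]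
  have hl1 : lieMV hpb U' β' x = lieAt X β x := by
    rw [lieAt, ← extD_contr_add (hX x hx) (hβ x hx) (by omega) (by omega)]
    change extD (contr hpb U' β') x - (-1 : ℝ) ^ (0 + 1) • contract _ (U' x) (extD β' x) = _
    rw [hc, hβd, hUx.self_of_nhds]
    exact sub_neg_one_smul _ _
  have hl2 : lieMV hqa V' τ' x = extD (contr hqa V' τ') x := by
    change extD (contr hqa V' τ') x - (-1 : ℝ) ^ (q + 1) • contract _ (V' x) (extD τ' x) = _
    rw [hτd, contract_zero, smul_zero, sub_zero]
  -- The coefficient (-1)^(q+1)/2 times d(2 ι_V τ) is exactly the second Lie derivative.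
  have hθx : ((-1 : ℝ) ^ (0 * (q + 1)) • lieMV hpb U' β' + (-1 : ℝ) ^ (q + 1) • lieMV hqa V' τ' -
          ((-1 : ℝ) ^ (q + 1) / 2) •
            extD (contr hqa V' τ' + (-1 : ℝ) ^ ((0 + 1) * (q + 1)) • contr hpb U' β')) x =
      lieAt X β x := by
    rw [hskew, extD_smul]
    change (-1 : ℝ) ^ (0 * (q + 1)) • lieMV hpb U' β' x + (-1 : ℝ) ^ (q + 1) • lieMV hqa V' τ' x -
      ((-1 : ℝ) ^ (q + 1) / 2) • (2 : ℝ) • extD (contr hqa V' τ') x = _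
    rw [hl1, hl2, zero_mul, pow_zero, one_smul, smul_smul, div_mul_cancel₀ _ two_ne_zero,
      add_sub_cancel_right]
  have hmem := hθ x
  have hsx := hs x
  rw [schouten_congr hUx hVx] at hsx
  refine ⟨hθx ▸ hmem, ?_⟩
  rw [← hsx]
  congr 1
  exact Subtype.ext hθx.symm

end GradedDirac

/-! ### Local sections, and Lie derivatives on (S^1)^{∧(j+1)} -/

namespace GradedDirac

open ContinuousAlternatingMap Filter Topology

variable {E : Type*} [NormedAddCommGroup E] [NormedSpace ℝ E] [FiniteDimensional ℝ E]
  {M : Type*} [TopologicalSpace M] [ChartedSpace E M] [IsManifold 𝓘(ℝ, E) ∞ M]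

theorem exists_rep {n : ℕ} (D : GradedDirac E M n) {a p : ℕ} (h : a + p = n + 1) (ha : 1 ≤ a)
    (hp : 1 ≤ p) {O : Set M} (hO : IsOpen O) {β : DForm E M a} (hβ : β.SmoothOn O)
    (hS : ∀ z ∈ O, β z ∈ D.S a z) {x : M} (hx : x ∈ O) :
    ∃ O' ⊆ O, IsOpen O' ∧ x ∈ O' ∧ ∃ U : MVField E M p, U.SmoothOn O' ∧ D.Rep h O' β U := by
  obtain ⟨O', hO', ho, hx', U, hU, hr⟩ := D.smooth a p h ha hp O hO β hβ hS x hx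
  exact ⟨O', hO', ho, hx', U, hU, fun z hz => ⟨hS z (hO' hz), hr z hz⟩⟩

theorem exists_vec_rep {n : ℕ} (D : GradedDirac E M n) (hn : 1 ≤ n) {O : Set M}
    (hO : IsOpen O) {β : DForm E M n} (hβ : β.SmoothOn O)
    (hS : ∀ z ∈ O, β z ∈ D.S n z) {x : M} (hx : x ∈ O) :
    ∃ O' ⊆ O, IsOpen O' ∧ x ∈ O' ∧ ∃ X : ∀ x : M, TangentSpace 𝓘(ℝ, E) x,
      VecSmoothOn X O' ∧ D.Rep rfl O' β (vecField X) := by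
  obtain ⟨O', hO', ho, hx', U, hU, hr⟩ := D.exists_rep rfl hn le_rfl hO hβ hS hx
  refine ⟨O', hO', ho, hx', fun z => toVec (U z), hU.toVec, ?_⟩
  rwa [vecField_toVec]

theorem smoothOn_sum {k r : ℕ} {s : Fin r → DForm E M k} {O : Set M} (hs : ∀ i, (s i).SmoothOn O)
    (c : Fin r → ℝ) : DForm.SmoothOn (fun z => ∑ i, c i • s i z) O := by
  intro x hx
  have h : DForm.rep (fun z => ∑ i, c i • s i z) x = fun y => ∑ i, c i • (s i).rep x y := by
    ext y v
    simp [DForm.rep, ContinuousAlternatingMap.sum_apply]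
  rw [h]
  exact ContDiffAt.sum fun i _ => (hs i x hx).const_smul (c i)

/-- Every element of `S^a` extends to a smooth local section. -/
theorem exists_section {n : ℕ} (D : GradedDirac E M n) {a : ℕ} (ha : 1 ≤ a) (han : a ≤ n) {x : M}
    (γ : TangentSpace 𝓘(ℝ, E) x [⋀^Fin a]→L[ℝ] ℝ) (hγ : γ ∈ D.S a x) :
    ∃ O : Set M, IsOpen O ∧ x ∈ O ∧ ∃ β : DForm E M a, β.SmoothOn O ∧
      (∀ z ∈ O, β z ∈ D.S a z) ∧ β x = γ := by
  obtain ⟨O, hO, hx, r, s, hs, hf⟩ := D.subbundle a ha han x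
  rw [← (hf x hx).2] at hγ
  obtain ⟨c, hc⟩ := (Submodule.mem_span_range_iff_exists_fun ℝ).1 hγ
  refine ⟨O, hO, hx, fun z => ∑ i, c i • s i z, smoothOn_sum hs c, fun z hz => ?_, hc⟩
  rw [← (hf z hz).2]
  exact Submodule.sum_mem _ fun i _ => Submodule.smul_mem _ _ (Submodule.subset_span ⟨i, rfl⟩)

theorem Rep.mono {n : ℕ} {D : GradedDirac E M n} {a p : ℕ} {h : a + p = n + 1} {O O' : Set M}
    {α : DForm E M a} {U : MVField E M p} (hr : D.Rep h O α U) (hO : O' ⊆ O) : D.Rep h O' α U :=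
  fun z hz => hr z (hO hz)

theorem curryLeft_comp_ofModel {k : ℕ} {x z : M} (hz : z ∈ (extChartAt 𝓘(ℝ, E) x).source)
    (h : 1 + k = k + 1) (v : E) (η : TangentSpace 𝓘(ℝ, E) z [⋀^Fin (k + 1)]→L[ℝ] ℝ) :
    (η.compContinuousLinearMap (ofModel x z)).curryLeft v =
      (contract h (ofVec (ofModel x z v)) η).compContinuousLinearMap (ofModel x z) := by
  rw [contract_comp_ofModel hz, toModel_ofModel hz]

theorem lieAt_comp_ofModel {k : ℕ} (X : ∀ x : M, TangentSpace 𝓘(ℝ, E) x) (β : DForm E M k)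
    (x : M) : (lieAt X β x).compContinuousLinearMap (ofModel x x) =
      flatLie (vecRep X x) (β.rep x) (pt x) :=
  comp_toModel_comp_ofModel (mem_extChartAt_source x) _

theorem linearIndependent_rep {k r : ℕ} {s : Fin r → DForm E M k} {x : M}
    (hs : LinearIndependent ℝ fun i => s i x) :
    LinearIndependent ℝ fun i => (s i).rep x (pt x) := by
  have hxs := mem_extChartAt_source (I := 𝓘(ℝ, E)) x
  have h1 := hs.map' (ContinuousAlternatingMap.compContinuousLinearMapₗ (ofModel x x))
    (LinearMap.ker_eq_bot.2 fun η χ hηχ => by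
      rw [← comp_ofModel_comp_toModel hxs η, ← comp_ofModel_comp_toModel hxs χ]
      exact congrArg (fun ζ => ContinuousAlternatingMap.compContinuousLinearMap ζ (toModel x x))
        hηχ)
  have h2 : (fun i => (s i).rep x (pt x)) =
      (ContinuousAlternatingMap.compContinuousLinearMapₗ (ofModel x x)) ∘ fun i => s i x :=
    funext fun i => rep_pt (s i) x
  rw [h2]
  exact h1

variable [T2Space M]

/-- The Lie derivative along a Hamiltonian vector field preserves the sections of
`(S^1)^{∧(j+1)}`. -/
theorem lieAt_mem_wedgePow {m j : ℕ} (D : GradedDirac E M (m + 1)) {O : Set M} (hO : IsOpen O)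
    {x : M} (hx : x ∈ O) {τ : DForm E M (m + 1)} (hτ : τ.SmoothOn O) (hd : extD τ x = 0)
    {X : ∀ x : M, TangentSpace 𝓘(ℝ, E) x} (hX : VecSmoothOn X O)
    (hXτ : D.Rep rfl O τ (vecField X)) {β : DForm E M (j + 1)} (hβ : β.SmoothOn O)
    (hβS : ∀ z ∈ O, β z ∈ wedgePow (D.S 1 z) (j + 1)) :
    lieAt X β x ∈ wedgePow (D.S 1 x) (j + 1) := by
  have hxs := mem_extChartAt_source (I := 𝓘(ℝ, E)) x
  obtain ⟨O₁, hO₁, hx₁, r, s, hs, hf⟩ := D.subbundle 1 le_rfl (by omega) x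
  have hsS : ∀ i, ∀ z ∈ O₁, s i z ∈ D.S 1 z := fun i z hz => by
    rw [← (hf z hz).2]; exact Submodule.subset_span ⟨i, rfl⟩
  -- `lieAt_mem` in degree 1: ♯_1 takes values of order m + 1 = n.
  have hlie : ∀ i, lieAt X (s i) x ∈ D.S 1 x := by
    intro i
    obtain ⟨O', hO', ho, hx', U, hU, hr⟩ := D.exists_rep (show 1 + (m + 1) = m + 1 + 1 by omega)
      le_rfl (by omega) (hO.inter hO₁) (β := s i) (fun z hz => hs i z hz.2)
      (fun z hz => hsS i z hz.2) ⟨hx, hx₁⟩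
    exact (D.lieAt_mem (k := 0) (q := m) (by omega) ho hx' (fun z hz => hτ z (hO' hz).1) hd
      (fun z hz => hX z (hO' hz).1) (hXτ.mono fun z hz => (hO' hz).1)
      (fun z hz => hs i z (hO' hz).2) hU hr).1
  have hli : LinearIndependent ℝ fun i => (s i).rep x (pt x) := linearIndependent_rep (hf x hx₁).1
  obtain ⟨q, hq⟩ := exists_smooth_dual_family (n := ∞) (fun i => (hs i x hx₁).continuousAt) hli
  have hqx : ∀ i, ContDiffAt ℝ ∞ (q i) (pt x) := hq.self_of_nhds.2 fun i => hs i x hx₁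
  refine mem_wedgePow _ _ fun w i hw => ?_
  set w₀ : E := toModel x x (w i) with hw₀
  -- A smooth extension of the kernel vector w₀ to a local section of the common kernel of S^1: the
  -- components of w₀ along the frame are removed by means of the dual family. At x there is nothing
  -- to remove.
  let W : E → E := fun y => w₀ - ∑ j, (s j).rep x y (fun _ => w₀) • toVecCLM (q j y)
  have hWs : ContDiffAt ℝ ∞ W (pt x) := by
    refine contDiffAt_const.sub (ContDiffAt.sum fun j _ => ContDiffAt.smul ?_ ?_)
    · exact contDiffAt_alt_apply (w := fun _ _ => w₀) (hs j x hx₁) fun _ => contDiffAt_const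
    · exact (contDiff_toVecCLM (E := E)).contDiffAt.comp _ (hqx j)
  have hWx : W (pt x) = w₀ := by
    refine sub_eq_self.2 (Finset.sum_eq_zero fun j _ => ?_)
    have h1 : (s j).rep x (pt x) (fun _ => w₀) = s j x (fun _ => w i) := by
      rw [rep_pt, compContinuousLinearMap_apply]
      congr 1
      exact funext fun _ => ofModel_toModel hxs (w i)
    rw [h1, hw _ (hsS j x hx₁), zero_smul]
  have hWker : ∀ᶠ y in 𝓝 (pt x), ∀ j, (s j).rep x y (fun _ => W y) = 0 := by
    filter_upwards [hq] with y hy j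
    have h1 : (s j).rep x y (fun _ => W y) = ofVecLin (W y) ((s j).rep x y) := rfl
    rw [h1, map_sub, _root_.map_sum, LinearMap.sub_apply, LinearMap.sum_apply]
    simp_rw [map_smul, LinearMap.smul_apply, ofVecLin_apply, ofVec_apply, apply_toVecCLM, hy.1]
    simp
  have hann : ∀ z ∈ O₁, ∀ v : TangentSpace 𝓘(ℝ, E) z, (∀ j, s j z (fun _ => v) = 0) →
      ofVec v ∈ ann (D.S 1 z) := by
    intro z hz v hv
    rw [Submodule.mem_dualAnnihilator, ← (hf z hz).2]
    intro η hη
    have hle : Submodule.span ℝ (Set.range fun j => s j z) ≤ LinearMap.ker (ofVec v) := by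
      rw [Submodule.span_le]
      rintro _ ⟨j, rfl⟩
      exact hv j
    exact hle hη
  have hbW : (fun y => (β.rep x y).curryLeft (W y)) =ᶠ[𝓝 (pt x)] fun _ => 0 := by
    have h1 : ∀ᶠ y in 𝓝 (pt x), (∀ j, (s j).rep x y (fun _ => W y) = 0) →
        (β.rep x y).curryLeft (W y) = 0 := by
      refine eventually_unchart_pt (p := fun y _ => (∀ j, (s j).rep x y (fun _ => W y) = 0) →
        (β.rep x y).curryLeft (W y) = 0) ?_
      filter_upwards [hO.mem_nhds hx, hO₁.mem_nhds hx₁] with z hz hz₁ hzs hW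
      rw [β.rep_chart hzs, curryLeft_comp_ofModel hzs (by omega)]
      have h2 := contract_wedgePow (D.S 1 z) (hann z hz₁
        (ofModel x z (W (extChartAt 𝓘(ℝ, E) x z))) fun j => by
          rw [← hW j, (s j).rep_chart hzs]; rfl) (hβS z hz)
      rw [h2]
      rfl
    filter_upwards [h1, hWker] with y h1 h2 using h1 h2
  -- Differentiating s_j(W) = 0 along X gives s_j([X, W]) = -(£_X s_j)(w i) at x. This is zero
  -- because £_X s_j lies in S^1 and w i in its kernel.
  have hlX : ∀ j, s j x (fun _ => ofModel x x
      (VectorField.lieBracket ℝ (vecRep X x) W (pt x))) = 0 := by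
    intro j
    have h0 : (fun y => ((s j).rep x y).curryLeft (W y)) =ᶠ[𝓝 (pt x)] fun _ => 0 := by
      filter_upwards [hWker] with y hy
      ext u
      rw [curryLeft_apply_apply]
      refine Eq.trans ?_ (hy j)
      congr 1
      ext l
      rw [Subsingleton.elim l 0]
      rfl
    have h1 := flatLie_curry (X := vecRep X x) ((hs j x hx₁).differentiableAt (by simp))
      (hWs.differentiableAt (by simp))
    rw [flatLie_congr _ h0, flatLie_zero, hWx] at h1
    have h2 := congrArg (fun F : E [⋀^Fin 0]→L[ℝ] ℝ => F ![]) h1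
    simp only [ContinuousAlternatingMap.add_apply, curryLeft_apply_apply] at h2
    have h3 : flatLie (vecRep X x) ((s j).rep x) (pt x) ![w₀] = lieAt X (s j) x (fun _ => w i) := by
      rw [lieAt, compContinuousLinearMap_apply]
      congr 1
      ext l
      rw [Subsingleton.elim l 0]
      rfl
    have h4 : (s j).rep x (pt x) ![VectorField.lieBracket ℝ (vecRep X x) W (pt x)] =
        s j x (fun _ => ofModel x x (VectorField.lieBracket ℝ (vecRep X x) W (pt x))) := by
      rw [rep_pt, compContinuousLinearMap_apply]
      congr 1
      ext l
      rw [Subsingleton.elim l 0]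
      rfl
    rw [h3, hw _ (hlie j), h4, add_zero] at h2
    exact h2.symm
  -- The same identity for β: ι_W β vanishes near x and ι_{[X,W]} β vanishes at x, which leaves ι_W
  -- £_X β = 0.
  have hmain := flatLie_curry (X := vecRep X x) ((hβ x hx).differentiableAt (by simp))
    (hWs.differentiableAt (by simp))
  rw [flatLie_congr _ hbW, flatLie_zero, hWx, rep_pt, curryLeft_comp_ofModel hxs (by omega),
    contract_wedgePow (D.S 1 x) (hann x hx₁ _ hlX) (hβS x hx)] at hmain
  have hzero : lieAt X β x (Matrix.vecCons (w i) (i.removeNth w)) = 0 := by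
    have h1 := congrArg (fun F : E [⋀^Fin j]→L[ℝ] ℝ => F (toModel x x ∘ i.removeNth w)) hmain
    simp only [ContinuousAlternatingMap.add_apply, curryLeft_apply_apply] at h1
    have h2 : lieAt X β x (Matrix.vecCons (w i) (i.removeNth w)) =
        flatLie (vecRep X x) (β.rep x) (pt x)
          (Matrix.vecCons w₀ (toModel x x ∘ i.removeNth w)) := by
      rw [lieAt, compContinuousLinearMap_apply]
      congr 1
      ext l
      refine Fin.cases ?_ (fun l => ?_) l <;> simp [hw₀]
    rw [h2]
    simpa using h1.symm
  -- The kernel vector sits in slot i; moving it to the front costs only a sign.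
  have hins := (lieAt X β x).toAlternatingMap.map_insertNth i (w i) (i.removeNth w)
  rw [Fin.insertNth_self_removeNth] at hins
  have hz' : (lieAt X β x).toAlternatingMap (Matrix.vecCons (w i) (i.removeNth w)) = 0 := hzero
  rw [hz', smul_zero] at hins
  exact hins

end GradedDirac

/-! ### The bracket and its differential -/

namespace GradedDirac

open ContinuousAlternatingMap Filter Topology

variable {E : Type*} [NormedAddCommGroup E] [NormedSpace ℝ E] [FiniteDimensional ℝ E]
  {M : Type*} [TopologicalSpace M] [ChartedSpace E M] [IsManifold 𝓘(ℝ, E) ∞ M]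

/-- The sign in the definition of `♯̃_1` on forms of degree `a + 1`, for `n = m + 1`. -/
def tildeSign (m a : ℕ) : ℝ := (-1 : ℝ) ^ (((m + 1 : ℕ) : ℤ) + 1 - (a + 1))

theorem tildeSign_mul_self (m a : ℕ) : tildeSign m a * tildeSign m a = 1 := by
  rw [tildeSign, ← mul_zpow]
  simp

/-- The exponents m - a and m + 1 - a have opposite parity. This produces the minus sign in {α, Θ} =
-ι_X dΘ and in the theorem. -/
theorem tildeSign_mul_bracketSign (m a : ℕ) :
    (-1 : ℝ) ^ ((m : ℤ) - a) * tildeSign m a = -1 := by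
  rw [tildeSign, ← zpow_add₀ (by norm_num)]
  have h : (m : ℤ) - a + (((m + 1 : ℕ) : ℤ) + 1 - (a + 1)) = 2 * (m - a) + 1 := by
    push_cast; ring
  rw [h, zpow_add₀ (by norm_num), zpow_mul]
  norm_num

theorem smul_smul_of_mul_eq_one {V : Type*} [AddCommGroup V] [Module ℝ V] {c : ℝ} (hc : c * c = 1)
    (v : V) : c • c • v = v := by
  rw [smul_smul, hc, one_smul]

variable {m a : ℕ} {D : GradedDirac E M (m + 1)}

theorem contract_extD_eq {Θ : DForm E M a} (hΘ : D.IsHamiltonianOne Θ) {z : M}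
    (γ : D.S (m + 1) z) {v : TangentSpace 𝓘(ℝ, E) z}
    (hv : Submodule.Quotient.mk (ofVec v) = D.sharp (m + 1) 1 rfl z γ) (h : 1 + a = a + 1) :
    contract h (ofVec v) (extD Θ z) =
      tildeSign m a • contractVF (D.S (m + 1) z) (D.tildeSharpD Θ hΘ z) γ :=
  contractVF_tildeSharp _ _ _ _ _ _ _ hv

theorem contractVF_eq {Θ : DForm E M a} (hΘ : D.IsHamiltonianOne Θ) {z : M}
    (γ : D.S (m + 1) z) {v : TangentSpace 𝓘(ℝ, E) z}
    (hv : Submodule.Quotient.mk (ofVec v) = D.sharp (m + 1) 1 rfl z γ) (h : 1 + a = a + 1) :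
    contractVF (D.S (m + 1) z) (D.tildeSharpD Θ hΘ z) γ =
      tildeSign m a • contract h (ofVec v) (extD Θ z) := by
  rw [contract_extD_eq hΘ γ hv, smul_smul, tildeSign_mul_self, one_smul]

theorem contractVF_of_represents {z : M} {n : ℕ}
    {S : Submodule ℝ (TangentSpace 𝓘(ℝ, E) z [⋀^Fin n]→L[ℝ] ℝ)}
    {ψ : TangentSpace 𝓘(ℝ, E) z [⋀^Fin a]→ₗ[ℝ] (MultiVec n (TangentSpace 𝓘(ℝ, E) z) ⧸ ann S)}
    {Ψ : TangentSpace 𝓘(ℝ, E) z [⋀^Fin a]→ₗ[ℝ] MultiVec n (TangentSpace 𝓘(ℝ, E) z)}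
    (h : ∀ v, Submodule.Quotient.mk (Ψ v) = ψ v) (γ : S) :
    contractVF S ψ γ = opEquiv Ψ γ := by
  ext v
  change quotAnnEquiv S (ψ v) γ = _
  rw [← h v]
  rfl

/-- Λ^n / K_n is the dual of S^n, so a class is tested by pairing with S^n. -/
theorem mk_eq_of_contractVF {z : M} {n : ℕ}
    {S : Submodule ℝ (TangentSpace 𝓘(ℝ, E) z [⋀^Fin n]→L[ℝ] ℝ)}
    {ψ : TangentSpace 𝓘(ℝ, E) z [⋀^Fin a]→ₗ[ℝ] (MultiVec n (TangentSpace 𝓘(ℝ, E) z) ⧸ ann S)}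
    {Ψ : TangentSpace 𝓘(ℝ, E) z [⋀^Fin a]→ₗ[ℝ] MultiVec n (TangentSpace 𝓘(ℝ, E) z)}
    (h : ∀ γ : S, contractVF S ψ γ = opEquiv Ψ γ) (v : Fin a → TangentSpace 𝓘(ℝ, E) z) :
    Submodule.Quotient.mk (Ψ v) = ψ v := by
  refine (quotAnnEquiv S).injective (LinearMap.ext fun γ => ?_)
  exact (congrArg (fun F : TangentSpace 𝓘(ℝ, E) z [⋀^Fin a]→L[ℝ] ℝ => F v) (h γ)).symm

/-- The defining relation of ♯̃_1 at γ = dα. It removes ♯̃_1 from the bracket, whose regularity and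
differential become those of ι_X dΘ. -/
theorem bracket_eq {α : DForm E M m} (hα : D.IsHamiltonian α) {Θ : DForm E M a}
    (hΘ : D.IsHamiltonianOne Θ) {z : M} {v : TangentSpace 𝓘(ℝ, E) z}
    (hv : Submodule.Quotient.mk (ofVec v) = D.hamVF α hα z) (h : 1 + a = a + 1) :
    D.bracket α hα Θ hΘ z = -contract h (ofVec v) (extD Θ z) := by
  rw [bracket, contractVF_eq hΘ _ hv h, smul_smul, tildeSign_mul_bracketSign]
  exact neg_one_smul ℝ (contract h (ofVec v) (extD Θ z))

variable {α : DForm E M m} {Θ : DForm E M a} {O : Set M} {X : ∀ x : M, TangentSpace 𝓘(ℝ, E) x}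

theorem bracket_smoothOn (hα : D.IsHamiltonian α) (hΘ : D.IsHamiltonianOne Θ)
    (hO : IsOpen O) (hX : VecSmoothOn X O)
    (hXα : ∀ z ∈ O, Submodule.Quotient.mk (ofVec (X z)) = D.hamVF α hα z) : (D.bracket α hα Θ hΘ).SmoothOn O := by
  intro x hx
  have h := DForm.SmoothOn.contr (Nat.add_comm 1 a) hX
    (fun z _ => hΘ.1.extD isOpen_univ z trivial) x hx
  refine h.neg.congr_of_eventuallyEq (DForm.rep_congr (η' := -contr (Nat.add_comm 1 a)
    (vecField X) (extD Θ)) ?_)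
  filter_upwards [hO.mem_nhds hx] with z hz
  exact bracket_eq hα hΘ (hXα z hz) _

/-- Cartan's formula for -ι_X dΘ, whose other term contains ddΘ = 0. -/
theorem extD_bracket (hα : D.IsHamiltonian α) (hΘ : D.IsHamiltonianOne Θ)
    (hO : IsOpen O) (hX : VecSmoothOn X O)
    (hXα : ∀ z ∈ O, Submodule.Quotient.mk (ofVec (X z)) = D.hamVF α hα z)
    {x : M} (hx : x ∈ O) :
    extD (D.bracket α hα Θ hΘ) x = -lieAt X (extD Θ) x := by
  have hs := (hΘ.1.extD isOpen_univ) x trivial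
  rw [lieAt, ← extD_contr_add (hX x hx) hs (by omega) (by omega)]
  have h1 : extD (D.bracket α hα Θ hΘ) x =
      extD ((-1 : ℝ) • contr (Nat.add_comm 1 a) (vecField X) (extD Θ)) x := by
    refine extD_congr ?_
    filter_upwards [hO.mem_nhds hx] with z hz
    rw [bracket_eq hα hΘ (hXα z hz) (Nat.add_comm 1 a)]
    exact (neg_one_smul ℝ (contract (Nat.add_comm 1 a) (ofVec (X z)) (extD Θ z))).symm
  have h2 : contr (Nat.add_comm 1 (a + 1)) (vecField X) (extD (extD Θ)) x = 0 := by
    rw [contr, extD_extD isOpen_univ hΘ.1 trivial, contract_zero]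
  rw [h1, h2, extD_smul, add_zero]
  exact neg_one_smul ℝ (extD (contr (Nat.add_comm 1 a) (vecField X) (extD Θ)) x)

/-- Contraction with a vector representing `♯_n(γ)`, in a chart. -/
theorem curryLeft_rep_eq (hΘ : D.IsHamiltonianOne Θ) {z x : M} (hz : z ∈ (extChartAt 𝓘(ℝ, E) x).source)
    (γ : D.S (m + 1) z) {v : TangentSpace 𝓘(ℝ, E) z}
    (hv : Submodule.Quotient.mk (ofVec v) = D.sharp (m + 1) 1 rfl z γ) {Ψ : MVForm E M a (m + 1)}
    (hΨ : ∀ v, Submodule.Quotient.mk (Ψ z v) = D.tildeSharpD Θ hΘ z v) :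
    ((extD Θ).rep x (extChartAt 𝓘(ℝ, E) x z)).curryLeft (toModel x z v) =
      tildeSign m a • Ψ.rep x (extChartAt 𝓘(ℝ, E) x z)
        ((γ : TangentSpace 𝓘(ℝ, E) z [⋀^Fin (m + 1)]→L[ℝ] ℝ).compContinuousLinearMap
          (ofModel x z)) := by
  rw [DForm.rep_chart _ hz, ← contract_comp_ofModel hz (Nat.add_comm 1 a),
    contract_extD_eq hΘ γ hv, contractVF_of_represents hΨ, MVForm.rep_chart _ hz,
    comp_ofModel_comp_toModel hz]
  rfl

variable [T2Space M]

theorem extD_bracket_mem (hα : D.IsHamiltonian α) (hΘ : D.IsHamiltonianOne Θ)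
    (hO : IsOpen O) (hX : VecSmoothOn X O)
    (hXα : ∀ z ∈ O, Submodule.Quotient.mk (ofVec (X z)) = D.hamVF α hα z)
    {x : M} (hx : x ∈ O) :
    extD (D.bracket α hα Θ hΘ) x ∈ wedgePow (D.S 1 x) (a + 1) := by
  rw [extD_bracket hα hΘ hO hX hXα hx]
  refine Submodule.neg_mem _ ?_
  exact D.lieAt_mem_wedgePow hO hx (fun z _ => hα.1.extD isOpen_univ z trivial)
    (extD_extD isOpen_univ hα.1 trivial) hX (fun z hz => ⟨hα.2 z, hXα z hz⟩)
    (fun z _ => hΘ.1.extD isOpen_univ z trivial) fun z _ => hΘ.2 z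

/-- Tested against γ ∈ S^n, extended to a local section χ with ♯_n(χ) represented by Y: the identity
is the Lie derivative along X of ι_Y dΘ = ε ι_Ψ χ. -/
theorem mk_lieVF_eq (hα : D.IsHamiltonian α) (hΘ : D.IsHamiltonianOne Θ)
    (hO : IsOpen O) (hX : VecSmoothOn X O)
    (hXα : ∀ z ∈ O, Submodule.Quotient.mk (ofVec (X z)) = D.hamVF α hα z)
    (hB : D.IsHamiltonianOne (D.bracket α hα Θ hΘ)) {Ψ : MVForm E M a (m + 1)}
    (hΨs : Ψ.SmoothOn O)
    (hΨ : ∀ z ∈ O, ∀ v, Submodule.Quotient.mk (Ψ z v) = D.tildeSharpD Θ hΘ z v) {x : M}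
    (hx : x ∈ O) (v : Fin a → TangentSpace 𝓘(ℝ, E) x) :
    Submodule.Quotient.mk (lieVF X Ψ x v) = (-D.tildeSharpD (D.bracket α hα Θ hΘ) hB x) v := by
  have hxs := mem_extChartAt_source (I := 𝓘(ℝ, E)) x
  refine mk_eq_of_contractVF (fun γ => ?_) v
  obtain ⟨O₁, hO₁, hx₁, χ, hχ, hχS, hχx⟩ := D.exists_section (by omega) le_rfl γ.1 γ.2
  obtain ⟨O₂, hO₂, ho₂, hx₂, Y, hY, hYχ⟩ := D.exists_vec_rep (by omega) (hO.inter hO₁)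
    (fun z hz => hχ z hz.2) (fun z hz => hχS z hz.2) ⟨hx, hx₁⟩
  have hOO : ∀ z ∈ O₂, z ∈ O := fun z hz => (hO₂ hz).1
  have hΘs := (hΘ.1.extD isOpen_univ) x trivial
  -- In top degree the representatives are vector fields: £_X χ lies in S^n and [X, Y] represents
  -- its image under ♯_n.
  obtain ⟨hL, hLs⟩ := D.lieAt_mem (k := m) (q := 0) (by omega) ho₂ hx₂
    (fun z _ => hα.1.extD isOpen_univ z trivial) (extD_extD isOpen_univ hα.1 trivial)
    (fun z hz => hX z (hOO z hz)) (fun z hz => ⟨hα.2 z, hXα z (hOO z hz)⟩)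
    (fun z hz => hχ z (hO₂ hz).2) hY.vecField hYχ
  have hXd : DifferentiableAt ℝ (vecRep X x) (pt x) := (hX x hx).differentiableAt (by simp)
  have hYd : DifferentiableAt ℝ (vecRep Y x) (pt x) := (hY x hx₂).differentiableAt (by simp)
  have hχd : DifferentiableAt ℝ (χ.rep x) (pt x) := (hχ x hx₁).differentiableAt (by simp)
  have hΨd : DifferentiableAt ℝ (Ψ.rep x) (pt x) := (hΨs x hx).differentiableAt (by simp)
  rw [schouten_vecField hXd hYd] at hLs
  -- ι_{[X,Y]} dΘ = ε ι_Ψ(£_X χ) at x: the pair of terms that will cancel.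
  have hbr := curryLeft_rep_eq hΘ hxs ⟨_, hL⟩ hLs.symm (hΨ x hx)
  rw [toModel_ofModel hxs, lieAt_comp_ofModel] at hbr
  have hev : (fun y => ((extD Θ).rep x y).curryLeft (vecRep Y x y)) =ᶠ[𝓝 (pt x)]
      fun y => tildeSign m a • Ψ.rep x y (χ.rep x y) := by
    refine eventually_unchart_pt (p := fun y _ => ((extD Θ).rep x y).curryLeft (vecRep Y x y) =
      tildeSign m a • Ψ.rep x y (χ.rep x y)) ?_
    filter_upwards [ho₂.mem_nhds hx₂] with z hz hzs
    obtain ⟨h1, h2⟩ := hYχ z hz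
    rw [vecRep_chart _ hzs, χ.rep_chart hzs]
    exact curryLeft_rep_eq hΘ hzs ⟨χ z, h1⟩ h2 (hΨ z (hOO z hz))
  -- Leibniz on both sides; after the cancellation through `hbr`, ι_Y £_X dΘ = ε ι_{£_X Ψ} χ remains
  -- at x.
  have hcalc := flatLie_congr (vecRep X x) hev
  rw [flatLie_curry (hΘs.differentiableAt (by simp)) hYd,
    flatLie_const_smul _ _ (hΨd.clm_apply hχd), flatLie_apply hΨd hχd, hbr, smul_add,
    add_comm, add_right_cancel_iff] at hcalc
  obtain ⟨h1, h2⟩ := hYχ x hx₂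
  have hγ : γ = ⟨χ x, h1⟩ := Subtype.ext hχx.symm
  have hneg : contractVF (D.S (m + 1) x) (-D.tildeSharpD (D.bracket α hα Θ hΘ) hB x) γ =
      -contractVF (D.S (m + 1) x) (D.tildeSharpD (D.bracket α hα Θ hΘ) hB x) γ := by
    ext v
    change quotAnnEquiv _ (-_) γ = -(quotAnnEquiv _ _ γ)
    rw [map_neg]
    rfl
  have hop : opEquiv (lieVF X Ψ x) γ =
      (flatLieOp (vecRep X x) (Ψ.rep x) (pt x) (χ.rep x (pt x))).compContinuousLinearMap
        (toModel x x) := by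
    rw [rep_pt, hχx]
    rfl
  have hL2 : contract (Nat.add_comm 1 a) (ofVec (Y x)) (lieAt X (extD Θ) x) =
      ((flatLie (vecRep X x) ((extD Θ).rep x) (pt x)).curryLeft
        (vecRep Y x (pt x))).compContinuousLinearMap (toModel x x) := by
    rw [vecRep_chart _ hxs, lieAt, contract_comp_toModel]
  rw [hneg, hop, contractVF_eq hB γ (hγ ▸ h2) (Nat.add_comm 1 a),
    extD_bracket hα hΘ hO hX hXα hx]
  have hmn : contract (Nat.add_comm 1 a) (ofVec (Y x)) (-lieAt X (extD Θ) x) =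
      -contract (Nat.add_comm 1 a) (ofVec (Y x)) (lieAt X (extD Θ) x) :=
    map_neg (contractForms (Nat.add_comm 1 a) (ofVec (Y x))) _
  rw [hmn, hL2, hcalc, smul_neg, neg_neg]
  exact smul_smul_of_mul_eq_one (tildeSign_mul_self m a) (compContinuousLinearMap
    (flatLieOp (vecRep X x) (Ψ.rep x) (pt x) (χ.rep x (pt x))) (toModel x x))

end GradedDirac

/-! ### Smooth local representatives of ♯̃_1(dΘ) -/

open ContinuousAlternatingMap Filter Topology

section

variable {E : Type*} [NormedAddCommGroup E] [NormedSpace ℝ E] [FiniteDimensional ℝ E]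
  {M : Type*} [TopologicalSpace M] [ChartedSpace E M] [IsManifold 𝓘(ℝ, E) ∞ M]

theorem contDiffAt_clm_of_apply {F G H : Type*} [NormedAddCommGroup F] [NormedSpace ℝ F]
    [FiniteDimensional ℝ F] [NormedAddCommGroup G] [NormedSpace ℝ G] [NormedAddCommGroup H]
    [NormedSpace ℝ H] {n : WithTop ℕ∞} {T : H → F →L[ℝ] G} {y : H}
    (h : ∀ v, ContDiffAt ℝ n (fun z => T z v) y) : ContDiffAt ℝ n T y := by
  let b := Module.finBasis ℝ F
  have h1 : T = fun z => ∑ i, ((b.coord i).toContinuousLinearMap).smulRight (T z (b i)) := by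
    ext z v
    have h2 : T z v = ∑ i, b.repr v i • T z (b i) := by
      conv_lhs => rw [← b.sum_repr v]
      rw [_root_.map_sum]
      exact Finset.sum_congr rfl fun i _ => map_smul _ _ _
    rw [h2]
    simp
  rw [h1]
  refine ContDiffAt.sum fun i _ => ContDiffAt.smulRight contDiffAt_const (h _)

/-- The multivector field with a given representation in the chart centred at `x`. -/
def MVField.ofChart {p : ℕ} (x : M) (q : E → (E [⋀^Fin p]→L[ℝ] ℝ) →L[ℝ] ℝ) : MVField E M p :=
  fun z => (q (extChartAt 𝓘(ℝ, E) x z)).toLinearMap ∘ₗ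
    ContinuousAlternatingMap.compContinuousLinearMapₗ (ofModel x z)

/-- In the chart at z the field is q precomposed with pull-back by the derivative of the transition
map, all evaluated at smoothly varying points. -/
theorem MVField.contDiffAt_rep_ofChart {p : ℕ} {x z : M} (hz : z ∈ (extChartAt 𝓘(ℝ, E) x).source)
    {q : E → (E [⋀^Fin p]→L[ℝ] ℝ) →L[ℝ] ℝ} (hq : ContDiffAt ℝ ∞ q (extChartAt 𝓘(ℝ, E) x z)) :
    ContDiffAt ℝ ∞ ((MVField.ofChart x q).rep z) (pt z) := by
  have hzz := mem_extChartAt_source (I := 𝓘(ℝ, E)) z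
  have ht := contDiffAt_trans (E := E) hzz hz
  have ht' := contDiffAt_trans (E := E) hz hzz
  have hzx : trans E z x (pt z) = extChartAt 𝓘(ℝ, E) x z := by
    rw [trans, Function.comp_apply, pt, (extChartAt 𝓘(ℝ, E) z).left_inv hzz]
  rw [← hzx] at hq ht'
  have hd : ContDiffAt ℝ ∞ (fun y => fderiv ℝ (trans E x z) (trans E z x y)) (pt z) :=
    (ht'.fderiv_right (m := ∞) (by simp)).comp (pt z) ht
  refine contDiffAt_clm_of_apply fun γ => ?_
  have hs : ContDiffAt ℝ ∞ (fun y => q (trans E z x y)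
      (γ.compContinuousLinearMap (fderiv ℝ (trans E x z) (trans E z x y)))) (pt z) :=
    (hq.comp (pt z) ht).clm_apply (contDiffAt_pullback contDiffAt_const hd)
  refine hs.congr_of_eventuallyEq ?_
  refine eventually_unchart_pt (p := fun y _ => (MVField.ofChart x q).rep z y γ =
    q (trans E z x y) (γ.compContinuousLinearMap (fderiv ℝ (trans E x z) (trans E z x y)))) ?_
  filter_upwards [extChartAt_source_mem_nhds' (I := 𝓘(ℝ, E)) hz] with w hwx hwz
  have hw : trans E z x (extChartAt 𝓘(ℝ, E) z w) = extChartAt 𝓘(ℝ, E) x w := by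
    rw [trans, Function.comp_apply, (extChartAt 𝓘(ℝ, E) z).left_inv hwz]
  rw [MVField.rep_chart _ hwz, hw, ← toModel_comp_ofModel_eq_fderiv hwx hwz]
  rfl

end

namespace GradedDirac

variable {E : Type*} [NormedAddCommGroup E] [NormedSpace ℝ E] [FiniteDimensional ℝ E]
  {M : Type*} [TopologicalSpace M] [ChartedSpace E M] [IsManifold 𝓘(ℝ, E) ∞ M]

variable {m a : ℕ} {D : GradedDirac E M (m + 1)}

/-- The multivector-valued form `∑ θ_i ⊗ u_i`. -/
def sumTensor {p r : ℕ} (u : Fin r → MVField E M p) (θ : Fin r → DForm E M a) : MVForm E M a p :=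
  fun z => opEquiv.symm (∑ i, (u i z).smulRight (θ i z))

theorem smoothOn_sumTensor {p r : ℕ} {u : Fin r → MVField E M p} {θ : Fin r → DForm E M a}
    {O : Set M} (hu : ∀ i, (u i).SmoothOn O) (hθ : ∀ i, (θ i).SmoothOn O) :
    (sumTensor u θ).SmoothOn O := by
  intro x hx
  have h : (sumTensor u θ).rep x = fun y => ∑ i, ((u i).rep x y).smulRight ((θ i).rep x y) := by
    ext y γ v
    rw [_root_.sum_apply, ContinuousAlternatingMap.sum_apply]
    change (∑ i, (u i (unchart x y)).smulRight (θ i (unchart x y))) _ _ = _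
    rw [LinearMap.sum_apply, ContinuousAlternatingMap.sum_apply]
    rfl
  rw [h]
  exact ContDiffAt.sum fun i _ => ContDiffAt.smulRight (hu i x hx) (hθ i x hx)

/-- `♯̃_1(dΘ)` has smooth local representatives. -/
theorem exists_tensor_rep {Θ : DForm E M a} (hΘ : D.IsHamiltonianOne Θ) (x : M) :
    ∃ O : Set M, IsOpen O ∧ x ∈ O ∧ ∃ Ψ : MVForm E M a (m + 1), Ψ.SmoothOn O ∧
      ∀ z ∈ O, ∀ v, Submodule.Quotient.mk (Ψ z v) = D.tildeSharpD Θ hΘ z v := by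
  have hxs := mem_extChartAt_source (I := 𝓘(ℝ, E)) x
  obtain ⟨O₁, hO₁, hx₁, r, s, hs, hf⟩ := D.subbundle (m + 1) (by omega) le_rfl x
  have hsS : ∀ i, ∀ z ∈ O₁, s i z ∈ D.S (m + 1) z := fun i z hz => by
    rw [← (hf z hz).2]; exact Submodule.subset_span ⟨i, rfl⟩
  choose O₂ hO₂ ho₂ hx₂ Y hY hYs using fun i => D.exists_vec_rep (by omega) hO₁ (hs i) (hsS i) hx₁
  have hli : LinearIndependent ℝ fun i => (s i).rep x (pt x) := linearIndependent_rep (hf x hx₁).1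
  obtain ⟨q, hq⟩ := exists_smooth_dual_family (n := ∞) (fun i => (hs i x hx₁).continuousAt) hli
  -- Duality and the inheritance of smoothness hold at every point near x, as smoothness on an open
  -- set requires.
  obtain ⟨O₃, hO₃, ho₃, hx₃⟩ := mem_nhds_iff.1
    ((continuousAt_extChartAt (I := 𝓘(ℝ, E)) x).eventually hq)
  let O := O₁ ∩ O₃ ∩ (extChartAt 𝓘(ℝ, E) x).source ∩ ⋂ i, O₂ i
  have hO : IsOpen O := ((hO₁.inter ho₃).inter (isOpen_extChartAt_source x)).inter
    (isOpen_iInter_of_finite ho₂)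
  -- The representative is ∑ ε ι_{Y_i} dΘ ⊗ q_i, where Y_i represents ♯_n(s_i). Its pairing with s_i
  -- is forced by the defining relation of ♯̃_1, and the dual family q_i extends it to all n-forms.
  refine ⟨O, hO, ⟨⟨⟨hx₁, hx₃⟩, hxs⟩, Set.mem_iInter.2 hx₂⟩,
    sumTensor (fun i => MVField.ofChart x (q i)) (fun i => tildeSign m a •
      contr (Nat.add_comm 1 a) (vecField (Y i)) (extD Θ)), ?_, ?_⟩
  · refine smoothOn_sumTensor (fun i z hz => ?_) fun i z hz => ?_
    · have h3 := (hO₃ hz.1.1.2).2 fun j => DForm.contDiffAt_rep hz.1.2 (hs j z hz.1.1.1)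
      exact MVField.contDiffAt_rep_ofChart hz.1.2 (h3 i)
    · exact ContDiffAt.const_smul (tildeSign m a) (DForm.SmoothOn.contr (Nat.add_comm 1 a) (hY i)
        (fun z _ => hΘ.1.extD isOpen_univ z trivial) z (Set.mem_iInter.1 hz.2 i))
  · intro z hz v
    refine mk_eq_of_contractVF (fun γ => ?_) v
    have hdual : ∀ i j, MVField.ofChart x (q i) z (s j z) = if i = j then 1 else 0 := by
      intro i j
      have h3 := (hO₃ hz.1.1.2).1 i j
      rw [(s j).rep_chart hz.1.2] at h3
      exact h3
    set c : Fin r → ℝ := fun i => MVField.ofChart x (q i) z γ.1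
    have hγ : ∑ i, c i • s i z = γ.1 := sum_dual_family hdual (by
      rw [(hf z hz.1.1.1).2]; exact γ.2)
    have hYz : ∀ i, Submodule.Quotient.mk (ofVec (Y i z)) =
        D.sharp (m + 1) 1 rfl z ⟨s i z, hsS i z hz.1.1.1⟩ := fun i =>
      (hYs i z (Set.mem_iInter.1 hz.2 i)).2
    -- By linearity of ♯_n, γ = ∑ c_i s_i is represented by ∑ c_i Y_i, so checking the frame
    -- suffices.
    have hsum : Submodule.Quotient.mk (ofVec (∑ i, c i • Y i z)) = D.sharp (m + 1) 1 rfl z γ := by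
      have h1 : γ = ∑ i, c i • (⟨s i z, hsS i z hz.1.1.1⟩ : D.S (m + 1) z) := by
        refine Subtype.ext ?_
        rw [← hγ, AddSubmonoidClass.coe_finsetSum]
        rfl
      rw [h1, _root_.map_sum, ← ofVecLin_apply, _root_.map_sum, ← Submodule.mkQ_apply,
        _root_.map_sum]
      refine Finset.sum_congr rfl fun i _ => ?_
      rw [map_smul, map_smul, map_smul, ← hYz i]
      rfl
    have hvec : contract (Nat.add_comm 1 a) (ofVec (∑ i, c i • Y i z)) (extD Θ z) =
        ∑ i, c i • contract (Nat.add_comm 1 a) (ofVec (Y i z)) (extD Θ z) := by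
      change contractVecs (Nat.add_comm 1 a) (extD Θ z) (ofVecLin (∑ i, c i • Y i z)) = _
      rw [_root_.map_sum, _root_.map_sum]
      refine Finset.sum_congr rfl fun i _ => ?_
      rw [map_smul, map_smul]
      rfl
    rw [contractVF_eq hΘ γ hsum (Nat.add_comm 1 a), hvec, Finset.smul_sum]
    change _ = (∑ i, (MVField.ofChart x (q i) z).smulRight ((tildeSign m a •
      contr (Nat.add_comm 1 a) (vecField (Y i)) (extD Θ)) z)) γ.1
    rw [LinearMap.sum_apply]
    refine Finset.sum_congr rfl fun i _ => ?_
    exact smul_comm _ _ _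

end GradedDirac

end GDirac

end

/-! ### The theorem -/

theorem mainTheorem8
    {E : Type*} [NormedAddCommGroup E] [NormedSpace ℝ E] [FiniteDimensional ℝ E]
    {M : Type*} [TopologicalSpace M] [T2Space M] [SecondCountableTopology M]
    [ChartedSpace E M] [IsManifold 𝓘(ℝ, E) ∞ M]
    (m : ℕ) (D : GDirac.GradedDirac E M (m + 1)) (a : ℕ)
    (α : GDirac.DForm E M m) (hα : D.IsHamiltonian α)
    (Θ : GDirac.DForm E M a) (hΘ : D.IsHamiltonianOne Θ) :
    ∃ hB : D.IsHamiltonianOne (D.bracket α hα Θ hΘ),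
      D.IsLieDerivative (D.hamVF α hα) (D.tildeSharpD Θ hΘ)
        (fun x => -D.tildeSharpD (D.bracket α hα Θ hΘ) hB x) := by
  -- Local representatives suffice: the bracket depends only on the class ♯_n(dα), and smoothness
  -- and membership are checked near each point.
  have hX : ∀ x, ∃ O : Set M, IsOpen O ∧ x ∈ O ∧
      ∃ X : ∀ x : M, TangentSpace 𝓘(ℝ, E) x, GDirac.VecSmoothOn X O ∧
        ∀ z ∈ O, Submodule.Quotient.mk (GDirac.ofVec (X z)) = D.hamVF α hα z := by
    intro x
    obtain ⟨O, -, hO, hx, X, hXs, hXr⟩ := D.exists_vec_rep (by omega) isOpen_univ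
      (hα.1.extD isOpen_univ) (fun z _ => hα.2 z) (Set.mem_univ x)
    exact ⟨O, hO, hx, X, hXs, fun z hz => (hXr z hz).2⟩
  have hB : D.IsHamiltonianOne (D.bracket α hα Θ hΘ) := by
    refine ⟨fun x _ => ?_, fun x => ?_⟩
    · obtain ⟨O, hO, hx, X, hXs, hXr⟩ := hX x
      exact GDirac.GradedDirac.bracket_smoothOn hα hΘ hO hXs hXr x hx
    · obtain ⟨O, hO, hx, X, hXs, hXr⟩ := hX x
      exact GDirac.GradedDirac.extD_bracket_mem hα hΘ hO hXs hXr hx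
  refine ⟨hB, fun x => ?_, fun O X Ψ hO hr x hx v => ?_⟩
  · obtain ⟨O, hO, hx, X, hXs, hXr⟩ := hX x
    obtain ⟨O', hO', hx', Ψ, hΨs, hΨr⟩ := GDirac.GradedDirac.exists_tensor_rep hΘ x
    exact ⟨O ∩ O', hO.inter hO', ⟨hx, hx'⟩, X, Ψ, fun z hz => hXs z hz.1, fun z hz => hΨs z hz.2,
      fun z hz => ⟨hXr z hz.1, hΨr z hz.2⟩⟩
  · obtain ⟨hXs, hΨs, hXΨ⟩ := hr
    exact GDirac.GradedDirac.mk_lieVF_eq hα hΘ hO hXs (fun z hz => (hXΨ z hz).1) hB hΨs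
      (fun z hz => (hXΨ z hz).2) hx v
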